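/- Theorem 1. Write $\operatorname{Log} x := \log(e+x)$ for $x\ge 0$ (so $\operatorname{Log}x\ge 1$, and $\operatorname{Log} x=\Theta(\log x)$ for $x$ bounded away from $1$ from above). Setting. An $n$-qubit Hamiltonian is given as $H=\sum_{\ell=1}^{L}\alpha_\ell P_\ell$ with real $\alpha_\ell$ and $n$-qubit Pauli operators $P_\ell$, and has total weight $\lambda=\sum_\ell|\alpha_\ell|>0$. Let $\Pi_{\min}$ be the projector onto the ground space of $H$ and $[H]_{\min}$ its ground state energy. An estimation algorithm runs $N$ quantum circuits independently. In each round it draws a classical random seed, which selects a circuit template on $n+1$ qubits (one ancilla and $n$ system qubits). A template is a finite list of instructions, each of which is either a fixed gate, or the instruction to draw a fresh index $\ell$ with probability $|\alpha_\ell|/\lambda$ and to insert gates determined by the signed Pauli operator $\operatorname{sgn}(\alpha_\ell)P_\ell$. Gates are Clifford gates (Hadamard, phase, CNOT) and single-qubit Pauli rotations $e^{i\theta P}$ with arbitrary angle. The resulting circuit is applied to $|0\rangle\langle 0|\otimes\rho$, that is, to one copy of $\rho$, and the ancilla is measured in the computational basis. The algorithm computes its estimate from the seeds and the measurement outcomes.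 Its seed distributions, templates and estimation rule depend only on $n,\lambda,\Delta,\eta,\xi$; the Hamiltonian enters only through the sampled terms. Claim. There is a universal constant $C>0$ such that for all $n$, $\lambda>0$, $\Delta>0$, $\eta\in(0,1]$ and $\xi\in(0,1)$ there is such an algorithm using $$N\le C\,\frac{1}{\eta^{2}}\operatorname{Log}^2\!\Big(\frac{\lambda}{\Delta}\operatorname{Log}\frac1\eta\Big)\operatorname{Log}\!\Big(\frac1\xi\operatorname{Log}\frac{\lambda}{\Delta}\Big)$$ circuits on $n+1$ qubits, each using one copy of $\rho$, with the following properties for every $n$-qubit Hamiltonian $H$ of total weight $\lambda$, whatever its number of terms $L$. Every circuit that can occur contains at most $C\,\frac{\lambda^2}{\Delta^2}\operatorname{Log}^2\frac1\eta$ single-qubit Pauli rotations; and for every $n$-qubit state $\rho$ with $\operatorname{tr}[\rho\,\Pi_{\min}]\ge\eta$, the estimate differs from $[H]_{\min}$ by at most $\Delta$ with probability at least $1-\xi$. -/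

import Mathlib

open scoped Matrix ENNReal ComplexOrder
open MeasureTheory

noncomputable section

namespace GroundEnergy

/-! ### Qubits, Pauli operators and gates

Computational basis states of a register with qubits labelled by `ι` are functions `ι → Fin 2`. -/

/-- Complex matrices acting on a register of qubits labelled by `ι`. -/
abbrev QMat (ι : Type) : Type := Matrix (ι → Fin 2) (ι → Fin 2) ℂ

/-- The four single-qubit Pauli labels. -/
inductive Pauli : Type
  | I | X | Y | Z

/-- The `2 × 2` matrix of a single-qubit Pauli operator. -/
def Pauli.mat : Pauli → Matrix (Fin 2) (Fin 2) ℂ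
  | .I => !![1, 0; 0, 1]
  | .X => !![0, 1; 1, 0]
  | .Y => !![0, -Complex.I; Complex.I, 0]
  | .Z => !![1, 0; 0, -1]

/-- An `n`-qubit Pauli operator, given by its tensor factors. -/
abbrev PauliString (n : ℕ) : Type := Fin n → Pauli

/-- The matrix of an `n`-qubit Pauli operator: the tensor product of its factors. -/
def PauliString.mat {n : ℕ} (P : PauliString n) : QMat (Fin n) :=
  Matrix.of fun x y => ∏ i, (P i).mat (x i) (y i)

/-- The single-qubit operator `A` acting on qubit `q`, tensored with the identity elsewhere. -/
def onQubit {ι : Type} [Fintype ι] [DecidableEq ι] (q : ι) (A : Matrix (Fin 2) (Fin 2) ℂ) :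
    QMat ι :=
  Matrix.of fun x y => if ∀ i, i ≠ q → x i = y i then A (x q) (y q) else 0

/-- Elementary gates: generators of the Clifford group (Hadamard, phase gate and CNOT), and
single-qubit Pauli rotations by an arbitrary angle. -/
inductive Gate (ι : Type) : Type
  | hadamard (q : ι)
  | phase (q : ι)
  | cnot (control target : ι) (h : control ≠ target)
  | rotation (P : Pauli) (q : ι) (θ : ℝ)

/-- The unitary matrix of a gate. The rotation is `exp(i θ P) = cos θ + i sin θ P` on one qubit. -/
def Gate.mat {ι : Type} [Fintype ι] [DecidableEq ι] : Gate ι → QMat ι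
  | .hadamard q => onQubit q ((((Real.sqrt 2)⁻¹ : ℝ) : ℂ) • !![1, 1; 1, -1])
  | .phase q => onQubit q !![1, 0; 0, Complex.I]
  | .cnot c t _ => Matrix.of fun x y => if x = Function.update y t (y t + y c) then 1 else 0
  | .rotation P q θ =>
      onQubit q (((Real.cos θ : ℝ) : ℂ) • 1 + (Complex.I * ((Real.sin θ : ℝ) : ℂ)) • P.mat)

/-- A circuit is a list of gates; the head of the list is applied first. -/
abbrev Circuit (ι : Type) : Type := List (Gate ι)

/-- The unitary implemented by a circuit. -/
def Circuit.mat {ι : Type} [Fintype ι] [DecidableEq ι] : Circuit ι → QMat ι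
  | [] => 1
  | g :: c => Circuit.mat c * g.mat

/-- The number of single-qubit Pauli rotations in a circuit (Clifford gates are not counted). -/
def Circuit.rotationCount {ι : Type} : Circuit ι → ℕ
  | [] => 0
  | .rotation _ _ _ :: c => Circuit.rotationCount c + 1
  | _ :: c => Circuit.rotationCount c

theorem onQubit_mul {ι : Type} [Fintype ι] [DecidableEq ι] (q : ι)
    (A B : Matrix (Fin 2) (Fin 2) ℂ) : onQubit q A * onQubit q B = onQubit q (A * B) := by
  ext x y
  rw [Matrix.mul_apply]
  have hinj : Function.Injective fun b : Fin 2 => Function.update x q b :=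
    Function.update_injective x q
  have h1 : ∑ z, onQubit q A x z * onQubit q B z y =
      ∑ b : Fin 2, onQubit q A x (Function.update x q b) *
        onQubit q B (Function.update x q b) y := by
    rw [← Finset.sum_image (f := fun z => onQubit q A x z * onQubit q B z y)
      (s := Finset.univ) (g := fun b : Fin 2 => Function.update x q b) (fun a _ b _ h => hinj h)]
    symm
    apply Finset.sum_subset (Finset.subset_univ _)
    intro z _ hz
    have : ¬ ∀ i, i ≠ q → x i = z i := by
      intro h
      apply hz
      rw [Finset.mem_image]
      refine ⟨z q, Finset.mem_univ _, ?_⟩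
      funext i
      by_cases hi : i = q
      · subst hi; simp
      · simp [hi, h i hi]
    simp [onQubit, this]
  rw [h1]
  have h2 : ∀ b, onQubit q A x (Function.update x q b) = A (x q) b := by
    intro b
    simp +contextual [onQubit, Function.update_of_ne]
  have h3 : ∀ b, onQubit q B (Function.update x q b) y =
      if ∀ i, i ≠ q → x i = y i then B b (y q) else 0 := by
    intro b
    have : (∀ i, i ≠ q → Function.update x q b i = y i) ↔ ∀ i, i ≠ q → x i = y i :=
      forall_congr' fun i => forall_congr' fun hi => by rw [Function.update_of_ne hi]
    simp only [onQubit, Matrix.of_apply, this, Function.update_self]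
  simp only [h2, h3]
  by_cases h : ∀ i, i ≠ q → x i = y i
  · simp only [onQubit, Matrix.of_apply, if_pos h, Matrix.mul_apply]
  · simp only [onQubit, Matrix.of_apply, if_neg h, mul_zero, Finset.sum_const_zero]

theorem onQubit_conjTranspose {ι : Type} [Fintype ι] [DecidableEq ι] (q : ι)
    (A : Matrix (Fin 2) (Fin 2) ℂ) : (onQubit q A)ᴴ = onQubit q Aᴴ := by
  ext x y
  have : (∀ i, i ≠ q → y i = x i) ↔ ∀ i, i ≠ q → x i = y i :=
    forall_congr' fun i => forall_congr' fun _ => eq_comm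
  simp only [onQubit, Matrix.conjTranspose_apply, Matrix.of_apply, this]
  split_ifs <;> simp

theorem onQubit_one {ι : Type} [Fintype ι] [DecidableEq ι] (q : ι) :
    onQubit q (1 : Matrix (Fin 2) (Fin 2) ℂ) = 1 := by
  ext x y
  by_cases h : x = y
  · subst h; simp [onQubit]
  · simp only [onQubit, Matrix.of_apply, Matrix.one_apply, h, if_false]
    split_ifs with h1 h2
    · exact absurd (funext fun i => by
        by_cases hi : i = q
        · rw [hi]; exact h2
        · exact h1 i hi) h
    · rfl
    · rfl

theorem Gate.conjTranspose_mul {ι : Type} [Fintype ι] [DecidableEq ι] (g : Gate ι) :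
    g.matᴴ * g.mat = 1 := by
  cases g with
  | hadamard q =>
    rw [Gate.mat, onQubit_conjTranspose, onQubit_mul, ← onQubit_one q]
    congr 1
    have h : (((Real.sqrt 2 : ℝ) : ℂ))⁻¹ * (((Real.sqrt 2 : ℝ) : ℂ))⁻¹ = 2⁻¹ := by
      rw [← mul_inv, ← Complex.ofReal_mul, Real.mul_self_sqrt (by norm_num)]
      norm_num
    ext i j
    fin_cases i <;> fin_cases j <;> simp [Matrix.mul_apply, Fin.sum_univ_two, h] <;> norm_num
  | phase q =>
    rw [Gate.mat, onQubit_conjTranspose, onQubit_mul, ← onQubit_one q]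
    congr 1
    ext i j
    fin_cases i <;> fin_cases j <;> simp [Matrix.mul_apply, Fin.sum_univ_two]
  | cnot c t hct =>
    have hinj : Function.Injective fun y : ι → Fin 2 => Function.update y t (y t + y c) := by
      intro y z h
      funext i
      have hc := congrFun h c
      have hi := congrFun h i
      simp only [Function.update_of_ne hct] at hc
      by_cases hit : i = t
      · subst hit
        simpa [hc] using hi
      · simpa [hit] using hi
    ext x y
    simp only [Gate.mat, Matrix.mul_apply, Matrix.conjTranspose_apply, Matrix.of_apply]
    rw [Finset.sum_eq_single (Function.update y t (y t + y c))]
    · by_cases h : x = y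
      · subst h; simp
      · have h' : ¬ Function.update y t (y t + y c) = Function.update x t (x t + x c) :=
          fun h'' => h (hinj h'').symm
        simp [h, h']
    · intro z _ hz
      simp [hz]
    · simp
  | rotation P q θ =>
    rw [Gate.mat, onQubit_conjTranspose, onQubit_mul, ← onQubit_one q]
    congr 1
    have h : Complex.cos θ * Complex.cos θ + Complex.sin θ * Complex.sin θ = 1 := by
      have := Complex.cos_sq_add_sin_sq (θ : ℂ)
      rw [sq, sq] at this
      exact this
    have hc : (starRingEnd ℂ) (Complex.cos θ) = Complex.cos θ := by
      rw [← Complex.ofReal_cos, Complex.conj_ofReal]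
    have hs : (starRingEnd ℂ) (Complex.sin θ) = Complex.sin θ := by
      rw [← Complex.ofReal_sin, Complex.conj_ofReal]
    ext i j
    cases P <;> fin_cases i <;> fin_cases j <;>
      simp [Matrix.mul_apply, Fin.sum_univ_two, Pauli.mat, hc, hs] <;>
      (try ring_nf) <;> (try rw [Complex.I_sq]) <;> (try rw [Complex.I_pow_four]) <;>
      (try linear_combination h)

theorem Circuit.conjTranspose_mul {ι : Type} [Fintype ι] [DecidableEq ι] (c : Circuit ι) :
    (Circuit.mat c)ᴴ * Circuit.mat c = 1 := by
  induction c with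
  | nil => simp [Circuit.mat]
  | cons g c ih =>
    rw [Circuit.mat, Matrix.conjTranspose_mul, Matrix.mul_assoc,
      ← Matrix.mul_assoc (Circuit.mat c)ᴴ, ih, Matrix.one_mul, Gate.conjTranspose_mul]

/-! ### States and measurement -/

/-- A state (density matrix) of `n` qubits. -/
structure QState (n : ℕ) : Type where
  mat : QMat (Fin n)
  posSemidef : mat.PosSemidef
  trace_eq_one : mat.trace = 1

/-- The isometry `|ψ⟩ ↦ |0⟩ ⊗ |ψ⟩` adjoining qubit `0` (the ancilla) to an `n`-qubit register. -/
def adjoinAncilla (n : ℕ) : Matrix (Fin (n + 1) → Fin 2) (Fin n → Fin 2) ℂ :=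
  Matrix.of fun x y => if x = Fin.cons 0 y then 1 else 0

theorem adjoinAncilla_conjTranspose_mul (n : ℕ) :
    (adjoinAncilla n)ᴴ * adjoinAncilla n = 1 := by
  ext x y
  simp only [adjoinAncilla, Matrix.mul_apply, Matrix.conjTranspose_apply, Matrix.of_apply]
  rw [Finset.sum_eq_single (Fin.cons 0 y)]
  · by_cases h : x = y
    · subst h; simp
    · have h' : ¬ (Fin.cons 0 y : Fin (n + 1) → Fin 2) = Fin.cons 0 x :=
        fun h'' => h (Fin.cons_right_injective _ h'').symm
      simp [h, h']
  · intro z _ hz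
    simp [hz]
  · simp

/-- The state of the `n + 1` qubits after running the circuit `c` on `|0⟩⟨0| ⊗ ρ`. -/
def finalState {n : ℕ} (c : Circuit (Fin (n + 1))) (ρ : QState n) : QMat (Fin (n + 1)) :=
  (Circuit.mat c * adjoinAncilla n) * ρ.mat * (Circuit.mat c * adjoinAncilla n)ᴴ

/-- Born's rule: the probability that measuring the ancilla in the computational basis gives `1`
(for `b = true`), respectively `0` (for `b = false`). -/
def outcomeProb {n : ℕ} (c : Circuit (Fin (n + 1))) (ρ : QState n) (b : Bool) : ℝ :=
  ∑ x with x 0 = (if b then (1 : Fin 2) else 0), (finalState c ρ x x).re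

theorem finalState_posSemidef {n : ℕ} (c : Circuit (Fin (n + 1))) (ρ : QState n) :
    (finalState c ρ).PosSemidef :=
  ρ.posSemidef.mul_mul_conjTranspose_same _

theorem finalState_trace {n : ℕ} (c : Circuit (Fin (n + 1))) (ρ : QState n) :
    (finalState c ρ).trace = 1 := by
  rw [finalState, Matrix.trace_mul_comm, ← Matrix.mul_assoc, Matrix.conjTranspose_mul,
    Matrix.mul_assoc (adjoinAncilla n)ᴴ, ← Matrix.mul_assoc (Circuit.mat c)ᴴ,
    Circuit.conjTranspose_mul, Matrix.one_mul, adjoinAncilla_conjTranspose_mul, Matrix.one_mul,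
    ρ.trace_eq_one]

theorem outcomeProb_nonneg {n : ℕ} (c : Circuit (Fin (n + 1))) (ρ : QState n) (b : Bool) :
    0 ≤ outcomeProb c ρ b :=
  Finset.sum_nonneg fun _ _ =>
    (Complex.le_def.1 (finalState_posSemidef c ρ).diag_nonneg).1

theorem outcomeProb_sum {n : ℕ} (c : Circuit (Fin (n + 1))) (ρ : QState n) :
    outcomeProb c ρ true + outcomeProb c ρ false = 1 := by
  have h := congrArg Complex.re (finalState_trace c ρ)
  rw [Matrix.trace, Complex.re_sum, Complex.one_re] at h
  rw [← h, ← Finset.sum_filter_add_sum_filter_not Finset.univ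
    (fun x : Fin (n + 1) → Fin 2 => x 0 = 1)]
  have hne : ∀ x : Fin (n + 1) → Fin 2, ¬ x 0 = 1 ↔ x 0 = 0 := fun x => by
    generalize x 0 = a
    revert a
    decide
  simp [outcomeProb, hne]

/-- The law of the outcome of measuring the ancilla after running `c` on `|0⟩⟨0| ⊗ ρ`. -/
def outcomeLaw {n : ℕ} (c : Circuit (Fin (n + 1))) (ρ : QState n) : PMF Bool :=
  PMF.ofFintype (fun b => ENNReal.ofReal (outcomeProb c ρ b)) (by
    rw [Fintype.sum_bool, ← ENNReal.ofReal_add (outcomeProb_nonneg _ _ _)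
      (outcomeProb_nonneg _ _ _), outcomeProb_sum, ENNReal.ofReal_one])

/-! ### Hamiltonians -/

/-- An `n`-qubit Hamiltonian presented as a real linear combination of Pauli operators
`∑ ℓ, coeff ℓ • term ℓ`, not all of whose coefficients vanish. -/
structure Hamiltonian (n : ℕ) : Type where
  numTerms : ℕ
  coeff : Fin numTerms → ℝ
  term : Fin numTerms → PauliString n
  weight_pos : 0 < ∑ l, |coeff l|

namespace Hamiltonian

variable {n : ℕ} (H : Hamiltonian n)

/-- The total weight `λ`. -/
def weight : ℝ := ∑ l, |H.coeff l|

/-- The Hamiltonian as a matrix. -/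
def mat : QMat (Fin n) := ∑ l, ((H.coeff l : ℝ) : ℂ) • (H.term l).mat

theorem isHermitian : H.mat.IsHermitian := by
  have hP : ∀ (P : Pauli) (a b : Fin 2), star (P.mat a b) = P.mat b a := by
    intro P a b
    cases P <;> fin_cases a <;> fin_cases b <;> simp [Pauli.mat]
  ext x y
  simp only [Hamiltonian.mat, Matrix.conjTranspose_apply, Matrix.sum_apply, Matrix.smul_apply,
    PauliString.mat, Matrix.of_apply, smul_eq_mul, star_sum, star_mul', star_prod, hP]
  simp

/-- The ground state energy: the smallest eigenvalue. -/
def groundEnergy : ℝ := ⨅ i, H.isHermitian.eigenvalues i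

/-- The orthogonal projection onto the ground space, as the spectral projection of the
Hamiltonian at the ground state energy. -/
def groundProjection : QMat (Fin n) :=
  H.isHermitian.cfc fun x => if x = H.groundEnergy then 1 else 0

/-- The overlap `tr[ρ Π]` of a state with the ground space. -/
def overlap (ρ : QState n) : ℝ := (ρ.mat * H.groundProjection).trace.re

/-- The distribution of a term index drawn with probability proportional to `|coeff l|`. -/
def termLaw : PMF (Fin H.numTerms) :=
  PMF.ofFintype (fun l => ENNReal.ofReal (|H.coeff l| / ∑ k, |H.coeff k|)) (by
    rw [← ENNReal.ofReal_sum_of_nonneg fun l _ => div_nonneg (abs_nonneg _) H.weight_pos.le,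
      ← Finset.sum_div, div_self H.weight_pos.ne', ENNReal.ofReal_one])

/-- What is revealed of a sampled term: its Pauli operator, with the sign of its coefficient
(`true` stands for a negative sign). -/
def signedTerm (l : Fin H.numTerms) : Bool × PauliString n :=
  (decide (H.coeff l < 0), H.term l)

end Hamiltonian

/-! ### Randomly compiled circuits and estimation algorithms -/

/-- One instruction of a circuit template on `n + 1` qubits. Either a fixed gate, or: draw a fresh
term of the Hamiltonian at random, and insert gates chosen according to the signed Pauli operator
that was drawn. -/
inductive Instruction (n : ℕ) : Type
  | gate (g : Gate (Fin (n + 1)))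
  | sampled (f : Bool × PauliString n → Circuit (Fin (n + 1)))

/-- The random circuit that results from executing a template, with terms of `H` drawn
independently with probability proportional to the absolute values of their coefficients. -/
def compile {n : ℕ} (H : Hamiltonian n) : List (Instruction n) → PMF (Circuit (Fin (n + 1)))
  | [] => PMF.pure []
  | .gate g :: T => (compile H T).map fun c => g :: c
  | .sampled f :: T => H.termLaw.bind fun l => (compile H T).map fun c => f (H.signedTerm l) ++ c

/-- An algorithm which estimates an energy from the outcomes of `numCircuits` circuits. In each
round a classical seed is drawn, which selects a circuit template; the compiled circuit is run on
`|0⟩⟨0| ⊗ ρ` and the ancilla is measured. The estimate is computed from the seeds and the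
measurement outcomes alone. -/
structure Algorithm (n : ℕ) : Type where
  numCircuits : ℕ
  seedLaw : Fin numCircuits → PMF ℕ
  template : Fin numCircuits → ℕ → List (Instruction n)
  estimate : (Fin numCircuits → ℕ × Bool) → ℝ

namespace Algorithm

variable {n : ℕ} (A : Algorithm n)

/-- The law of the circuit run in round `i`. -/
def circuitLaw (H : Hamiltonian n) (i : Fin A.numCircuits) : PMF (Circuit (Fin (n + 1))) :=
  (A.seedLaw i).bind fun s => compile H (A.template i s)

/-- The joint law of the seed and the measurement outcome in round `i`. -/
def roundLaw (H : Hamiltonian n) (ρ : QState n) (i : Fin A.numCircuits) : PMF (ℕ × Bool) :=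
  (A.seedLaw i).bind fun s =>
    (compile H (A.template i s)).bind fun c => (outcomeLaw c ρ).map fun b => (s, b)

/-- The joint law of all seeds and measurement outcomes; the rounds are independent. -/
def law (H : Hamiltonian n) (ρ : QState n) : Measure (Fin A.numCircuits → ℕ × Bool) :=
  Measure.pi fun i => (A.roundLaw H ρ i).toMeasure

end Algorithm

/-- The logarithm in the complexity bounds, `log (e + x)`: it agrees with `log x` up to constant
factors when `x` is bounded away from `1` from above, and is at least `1` for all `x ≥ 0`. -/
def plog (x : ℝ) : ℝ := Real.log (Real.exp 1 + x)

end GroundEnergy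

end

noncomputable section

namespace GroundEnergy

/-! ### Tensor products of single-qubit operators -/

/-! Write `E` for the ground energy, `λ` for the weight and `δ = Δ/(16λ)`. Suppose `G` is a real
trigonometric polynomial of degree `d` with `G ≥ 0` everywhere, `G ≥ 1` on `[δ, 1]` and `G ≤ η/4` on
`[-1, -δ]`. Average `G((x - energy)/(4λ))` over the energy distribution of `ρ`. For `x ≤ E - Δ/4`
all energies lie to the right of `x`, and the average is at most `η/4`; for `x ≥ E + Δ/4` the ground
space alone contributes at least `η`, and the other energies cannot subtract. Estimating this
function of `x` to accuracy `O(η)` therefore decides on which side of `x` the energy `E` lies, and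
bisection finds `E`.

The Fourier modes of the average are traces of `ρ` against evolutions `exp(-i j H/(4λ))`. A rotation
about a randomly drawn signed Pauli operator has mean exactly `cos θ + i sin θ H/λ`
(`sum_rot_signedTerm`), whatever the number of terms. By independence, Hadamard tests on `N` sampled
rotations estimate the `N`-th power of this without bias. Dividing each step by `cos θ` gives `1 + i
tan θ H/λ`, and averaging the powers over a Poisson number `N` of mean `ν` gives `exp(i ν tan θ
H/λ)` exactly (`stepWeight_mul`, `norm_sum_step_sub_exp_le`). For `ν = d²` and modes `|j| ≤ d` the
division inflates the total weight by at most `2`, and discarding `N ≥ 13 d²` costs only `exp(-8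
d²)`. Hence `O(d²)` rotations suffice.

The filter (`exists_step_filter`) is the mass of a normalized power of the Fejér kernel in a
quarter-circle window. Width about `1/δ` and exponent about `Log(1/η)` give `d = O(Log(1/η)/δ)`. Its
coefficients have absolute sum only `O(1 + log d)`, by Parseval and a Schur test against the `1/|k|`
decay of the window's coefficients. Drawing seeds in proportion to the absolute coefficients makes
each sample bounded by `O(1 + log d)`, and Hoeffding's inequality yields the `Log²/η²` sample count.

The same samples serve every `x`. Although bisection is adaptive, its success is decided on a fixed
set of `O(Log(λ/Δ))` points (`exists_bisect_points`), so a union bound costs only the logarithm of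
that number. `exists_algorithm_of_filter` combines these ingredients. -/

/-- The tensor product of a family of single-qubit operators. -/
def tensorProd {ι : Type} [Fintype ι] (M : ι → Matrix (Fin 2) (Fin 2) ℂ) : QMat ι :=
  Matrix.of fun x y => ∏ i, M i (x i) (y i)

theorem PauliString.mat_eq_tensorProd {n : ℕ} (P : PauliString n) :
    P.mat = tensorProd fun i => (P i).mat := rfl

section

variable {ι : Type} [Fintype ι] [DecidableEq ι]

theorem tensorProd_mul (M N : ι → Matrix (Fin 2) (Fin 2) ℂ) :
    tensorProd M * tensorProd N = tensorProd fun i => M i * N i := by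
  ext x y
  simp only [tensorProd, Matrix.mul_apply, Matrix.of_apply, ← Finset.prod_mul_distrib]
  rw [Finset.prod_univ_sum, Fintype.piFinset_univ]

theorem onQubit_eq_tensorProd (q : ι) (A : Matrix (Fin 2) (Fin 2) ℂ) :
    onQubit q A = tensorProd (Function.update (fun _ => 1) q A) := by
  ext x y
  simp only [onQubit, tensorProd, Matrix.of_apply]
  rw [Fintype.prod_eq_mul_prod_compl q]
  have : ∀ i ∈ ({q}ᶜ : Finset ι),
      Function.update (fun _ => (1 : Matrix (Fin 2) (Fin 2) ℂ)) q A i (x i) (y i) =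
        if x i = y i then 1 else 0 := by
    intro i hi
    have hi' : i ≠ q := by simpa using hi
    rw [Function.update_of_ne hi', Matrix.one_apply]
  rw [Finset.prod_congr rfl this, Function.update_self]
  by_cases h : ∀ i, i ≠ q → x i = y i
  · rw [if_pos h, Finset.prod_eq_one, mul_one]
    intro i hi
    rw [if_pos (h i (by simpa using hi))]
  · rw [if_neg h]
    push Not at h
    obtain ⟨i, hi, hxy⟩ := h
    rw [Finset.prod_eq_zero (i := i) (by simpa using hi) (by simp [hxy]), mul_zero]

theorem Circuit.mat_append (c d : Circuit ι) :
    Circuit.mat (c ++ d) = Circuit.mat d * Circuit.mat c := by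
  induction c with
  | nil => simp [Circuit.mat]
  | cons g c ih => rw [List.cons_append, Circuit.mat, ih, Circuit.mat, Matrix.mul_assoc]

theorem Circuit.mat_singleton (g : Gate ι) : Circuit.mat [g] = g.mat := by
  simp [Circuit.mat]

end

theorem Circuit.rotationCount_append {ι : Type} (c d : Circuit ι) :
    Circuit.rotationCount (c ++ d) = Circuit.rotationCount c + Circuit.rotationCount d := by
  induction c with
  | nil => simp [Circuit.rotationCount]
  | cons g c ih =>
    cases g <;> simp only [List.cons_append, Circuit.rotationCount, ih]
    omega

/-- The Pauli rotation `exp(i θ A) = cos θ + i sin θ A`, for `A` with `A² = 1`. -/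
def rot {m : Type} [DecidableEq m] (A : Matrix m m ℂ) (θ : ℝ) : Matrix m m ℂ :=
  ((Real.cos θ : ℝ) : ℂ) • 1 + (Complex.I * ((Real.sin θ : ℝ) : ℂ)) • A

theorem rot_zero {m : Type} [DecidableEq m] (A : Matrix m m ℂ) : rot A 0 = 1 := by
  simp [rot]

theorem rot_mul_rot {m : Type} [Fintype m] [DecidableEq m] {A : Matrix m m ℂ} (hA : A * A = 1)
    (α β : ℝ) : rot A α * rot A β = rot A (α + β) := by
  simp only [rot, Matrix.add_mul, Matrix.mul_add, Matrix.smul_mul, Matrix.mul_smul, Matrix.one_mul,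
    Matrix.mul_one, hA, Real.cos_add, Real.sin_add]
  have hI : Complex.I * Complex.I = -1 := Complex.I_mul_I
  push_cast
  rw [smul_add, smul_add, smul_smul, smul_smul, smul_smul, smul_smul,
    show Complex.I * Complex.sin β * (Complex.I * Complex.sin α) =
    -(Complex.sin α * Complex.sin β) by linear_combination (Complex.sin α * Complex.sin β) * hI]
  module

theorem conj_rot {m : Type} [Fintype m] [DecidableEq m] (A B C : Matrix m m ℂ) (h : B * C = 1)
    (θ : ℝ) : B * rot A θ * C = rot (B * A * C) θ := by
  simp only [rot, Matrix.add_mul, Matrix.mul_add, Matrix.smul_mul, Matrix.mul_smul, Matrix.mul_one,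
    h]

/-! ### Multi-qubit Pauli rotations as circuits -/

/-- The rotations about the Pauli operator `Q` are implemented by circuits with at most one
single-qubit rotation. -/
def IsRotatable {n : ℕ} (Q : PauliString n) : Prop :=
  ∀ θ : ℝ, ∃ c : Circuit (Fin n), Circuit.mat c = rot Q.mat θ ∧ Circuit.rotationCount c ≤ 1

/-- Conjugation by Clifford circuits commutes with forming rotations and adds no rotation gates. -/
theorem IsRotatable.conj {n : ℕ} {Q Q' : PauliString n} (hQ : IsRotatable Q)
    (c d : Circuit (Fin n)) (hc : Circuit.rotationCount c = 0) (hd : Circuit.rotationCount d = 0)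
    (h1 : Circuit.mat d * Circuit.mat c = 1)
    (h2 : Circuit.mat d * Q.mat * Circuit.mat c = Q'.mat) : IsRotatable Q' := by
  intro θ
  obtain ⟨e, he, hcount⟩ := hQ θ
  refine ⟨c ++ (e ++ d), ?_, ?_⟩
  · rw [Circuit.mat_append, Circuit.mat_append, he, conj_rot _ _ _ h1, h2]
  · rw [Circuit.rotationCount_append, Circuit.rotationCount_append]
    omega

theorem IsRotatable.conj_onQubit {n : ℕ} {Q : PauliString n} (hQ : IsRotatable Q) (i : Fin n)
    (B : Pauli) (U V : Matrix (Fin 2) (Fin 2) ℂ) (c d : Circuit (Fin n))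
    (hc : Circuit.rotationCount c = 0) (hd : Circuit.rotationCount d = 0)
    (hcU : Circuit.mat c = onQubit i U) (hdV : Circuit.mat d = onQubit i V) (hVU : V * U = 1)
    (hB : V * (Q i).mat * U = B.mat) : IsRotatable (Function.update Q i B) := by
  refine hQ.conj c d hc hd ?_ ?_
  · rw [hcU, hdV, onQubit_mul, hVU, onQubit_one]
  · rw [hcU, hdV, PauliString.mat_eq_tensorProd, onQubit_eq_tensorProd, onQubit_eq_tensorProd,
      tensorProd_mul, tensorProd_mul, PauliString.mat_eq_tensorProd]
    congr 1
    funext k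
    by_cases hk : k = i
    · subst hk; simp [hB]
    · simp [hk]

theorem sqrt_two_inv_mul_self :
    (((Real.sqrt 2 : ℝ) : ℂ))⁻¹ * (((Real.sqrt 2 : ℝ) : ℂ))⁻¹ = 2⁻¹ := by
  rw [← mul_inv, ← Complex.ofReal_mul, Real.mul_self_sqrt (by norm_num)]
  norm_num

/-- `S X S† = Y` and `H X H = Z`; `S†` is implemented as the cube of the phase gate `S`. -/
theorem IsRotatable.update_of_X {n : ℕ} {Q : PauliString n} (hQ : IsRotatable Q) (i : Fin n)
    (hi : Q i = .X) {B : Pauli} (hB : B ≠ .I) : IsRotatable (Function.update Q i B) := by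
  cases B with
  | I => exact absurd rfl hB
  | X => rwa [← hi, Function.update_eq_self]
  | Y =>
    refine hQ.conj_onQubit i .Y !![1, 0; 0, -Complex.I] !![1, 0; 0, Complex.I]
      [.phase i, .phase i, .phase i] [.phase i] rfl rfl ?_ (Circuit.mat_singleton _) ?_ ?_
    · simp only [Circuit.mat, Gate.mat, Matrix.one_mul, onQubit_mul]
      congr 1
      ext a b
      fin_cases a <;> fin_cases b <;> simp [Matrix.mul_apply, Fin.sum_univ_two]
    · ext a b
      fin_cases a <;> fin_cases b <;> simp [Matrix.mul_apply, Fin.sum_univ_two]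
    · rw [hi]
      ext a b
      fin_cases a <;> fin_cases b <;> simp [Pauli.mat, Matrix.mul_apply, Fin.sum_univ_two]
  | Z =>
    have h := sqrt_two_inv_mul_self
    refine hQ.conj_onQubit i .Z _ _ [.hadamard i] [.hadamard i] rfl rfl
      (Circuit.mat_singleton _) (Circuit.mat_singleton _) ?_ ?_
    · ext a b
      fin_cases a <;> fin_cases b <;> simp [Matrix.mul_apply, Fin.sum_univ_two, h] <;> norm_num
    · rw [hi]
      ext a b
      fin_cases a <;> fin_cases b <;>
        simp [Pauli.mat, Matrix.mul_apply, Fin.sum_univ_two, h] <;> norm_num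

theorem cnot_mat_mul_self {ι : Type} [Fintype ι] [DecidableEq ι] (c t : ι) (h : c ≠ t) :
    (Gate.cnot c t h).mat * (Gate.cnot c t h).mat = 1 := by
  have hH : (Gate.cnot c t h).matᴴ = (Gate.cnot c t h).mat := by
    ext x y
    simp only [Gate.mat, Matrix.conjTranspose_apply, Matrix.of_apply]
    have : y = Function.update x t (x t + x c) ↔ x = Function.update y t (y t + y c) := by
      have key : ∀ x y : ι → Fin 2, y = Function.update x t (x t + x c) →
          x = Function.update y t (y t + y c) := by
        intro x y hxy
        subst hxy
        have h2 : ∀ a b : Fin 2, a + b + b = a := by decide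
        simp [h, h2]
      exact ⟨key x y, key y x⟩
    simp only [this]
    split_ifs <;> simp
  have := Gate.conjTranspose_mul (Gate.cnot c t h)
  rwa [hH] at this

theorem cnot_conj_apply {ι : Type} [Fintype ι] [DecidableEq ι] (c t : ι) (h : c ≠ t)
    (A : QMat ι) (x y : ι → Fin 2) :
    ((Gate.cnot c t h).mat * A * (Gate.cnot c t h).mat) x y =
      A (Function.update x t (x t + x c)) (Function.update y t (y t + y c)) := by
  have h2 : ∀ a b : Fin 2, a + b + b = a := by decide
  have key : ∀ x z : ι → Fin 2, x = Function.update z t (z t + z c) ↔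
      z = Function.update x t (x t + x c) := by
    have key' : ∀ x y : ι → Fin 2, y = Function.update x t (x t + x c) →
        x = Function.update y t (y t + y c) := by
      intro x y hxy
      subst hxy
      simp [h, h2]
    exact fun x z => ⟨key' z x, key' x z⟩
  simp only [Gate.mat, Matrix.mul_apply, Matrix.of_apply, mul_ite, mul_one, mul_zero, ite_mul,
    one_mul, zero_mul]
  rw [Finset.sum_ite_eq' Finset.univ (Function.update y t (y t + y c))]
  simp only [Finset.mem_univ, if_true, key x]
  rw [Finset.sum_ite_eq']
  simp

/-- Conjugation by CNOT maps `X` on the control to `X ⊗ X`, which enlarges the support by the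
target. -/
theorem IsRotatable.cnot {n : ℕ} {Q : PauliString n} (hQ : IsRotatable Q) {q i : Fin n}
    (hqi : q ≠ i) (hq : Q q = .X) (hi : Q i = .I) : IsRotatable (Function.update Q i .X) := by
  refine hQ.conj [.cnot q i hqi] [.cnot q i hqi] rfl rfl ?_ ?_
  · rw [Circuit.mat_singleton, cnot_mat_mul_self]
  · rw [Circuit.mat_singleton]
    ext x y
    rw [cnot_conj_apply]
    simp only [PauliString.mat, Matrix.of_apply]
    rw [Fintype.prod_eq_mul_prod_compl i, Fintype.prod_eq_mul_prod_compl i]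
    rw [← Finset.mul_prod_erase ({i}ᶜ : Finset (Fin n)) _ (a := q) (by simpa using hqi),
      ← Finset.mul_prod_erase ({i}ᶜ : Finset (Fin n)) _ (a := q) (by simpa using hqi),
      ← mul_assoc, ← mul_assoc]
    congr 1
    · simp only [Function.update_self, Function.update_of_ne hqi, hq, hi]
      generalize x q = a, x i = b, y q = c, y i = d
      fin_cases a <;> fin_cases b <;> fin_cases c <;> fin_cases d <;> simp [Pauli.mat]
    · refine Finset.prod_congr rfl fun k hk => ?_
      have hk' : k ≠ i := by
        have := (Finset.mem_erase.1 hk).2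
        simpa using this
      simp only [Function.update_of_ne hk']

/-- Induction on the support: starting from one rotation about `X` on `q`, a CNOT controlled by `q`
plants an `X` on each further qubit, and a one-qubit Clifford conjugation turns it into the required
letter. -/
theorem isRotatable_of_apply_X {n : ℕ} (Q : PauliString n) (q : Fin n) (hq : Q q = .X) :
    IsRotatable Q := by
  classical
  have key : ∀ s : Finset (Fin n), q ∉ s →
      IsRotatable fun i => if i = q then Pauli.X else if i ∈ s then Q i else .I := by
    intro s
    induction s using Finset.induction_on with
    | empty =>
      intro _ θ
      refine ⟨[.rotation .X q θ], ?_, le_rfl⟩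
      have hX : (PauliString.mat fun i => if i = q then Pauli.X else
          if i ∈ (∅ : Finset (Fin n)) then Q i else .I) = onQubit q Pauli.X.mat := by
        rw [onQubit_eq_tensorProd, PauliString.mat_eq_tensorProd]
        congr 1
        funext i
        have hI : Pauli.I.mat = 1 := by
          ext a b; fin_cases a <;> fin_cases b <;> simp [Pauli.mat]
        by_cases hi : i = q
        · subst hi; simp
        · simp [hi, hI]
      rw [Circuit.mat_singleton, hX, Gate.mat, rot, ← onQubit_one q]
      ext x y
      simp only [onQubit, Matrix.of_apply, Matrix.add_apply, Matrix.smul_apply]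
      split_ifs <;> simp
    | insert i s his ih =>
      intro hqs
      have hqi : q ≠ i := fun h => hqs (by simp [h])
      have hq' : q ∉ s := fun h => hqs (Finset.mem_insert_of_mem h)
      have h0 := ih hq'
      by_cases hQi : Q i = .I
      · convert h0 using 2 with k
        by_cases hk : k = i
        · subst hk; simp [hQi]
        · simp [hk]
      · have h1 := h0.cnot hqi (by simp) (by simp [hqi.symm, his])
        have h2 := h1.update_of_X i (by simp) hQi
        convert h2 using 1
        funext k
        by_cases hk : k = i
        · subst hk; simp [hqi.symm]
        · simp [hk]
  convert key (Finset.univ.erase q) (by simp) using 1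
  funext i
  by_cases hi : i = q
  · subst hi; simp [hq]
  · simp [hi]

/-- A non-identity letter is replaced by `X` and restored at the end. The identity string only gives
a global phase, which still has to be matched as a matrix; the rotation labelled `I` does this, and
it needs a qubit to act on, hence `n + 1`. -/
theorem isRotatable {n : ℕ} (Q : PauliString (n + 1)) : IsRotatable Q := by
  by_cases h : ∃ q, Q q ≠ .I
  · obtain ⟨q, hq⟩ := h
    have := (isRotatable_of_apply_X (Function.update Q q .X) q (by simp)).update_of_X q
      (by simp) hq
    simpa using this
  · push Not at h
    intro θ
    refine ⟨[.rotation .I 0 θ], ?_, le_rfl⟩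
    have hI : Pauli.I.mat = 1 := by
      ext a b; fin_cases a <;> fin_cases b <;> simp [Pauli.mat]
    have hQ : Q.mat = onQubit 0 1 := by
      rw [onQubit_eq_tensorProd, PauliString.mat_eq_tensorProd]
      congr 1
      funext i
      simp [h, hI]
    rw [Circuit.mat_singleton, hQ, Gate.mat, rot, hI, ← onQubit_one 0]
    ext x y
    simp only [onQubit, Matrix.of_apply, Matrix.add_apply, Matrix.smul_apply]
    split_ifs <;> simp

theorem PauliString.mat_mul_self {n : ℕ} (P : PauliString n) : P.mat * P.mat = 1 := by
  rw [mat_eq_tensorProd, tensorProd_mul]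
  have h : ∀ A : Pauli, A.mat * A.mat = 1 := by
    intro A
    ext a b
    cases A <;> fin_cases a <;> fin_cases b <;>
      simp [Pauli.mat, Matrix.mul_apply, Fin.sum_univ_two]
  simp only [h]
  ext x y
  simp only [tensorProd, Matrix.of_apply, Matrix.one_apply]
  by_cases hxy : x = y
  · simp [hxy]
  · rw [if_neg hxy]
    obtain ⟨i, hi⟩ := Function.ne_iff.1 hxy
    exact Finset.prod_eq_zero (Finset.mem_univ i) (by simp [hi])

/-! ### Block matrices with respect to the ancilla -/

theorem sum_cons_fin_two {n : ℕ} {M : Type} [AddCommMonoid M] (f : (Fin (n + 1) → Fin 2) → M) :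
    ∑ x, f x = ∑ y : Fin n → Fin 2, f (Fin.cons 0 y) + ∑ y : Fin n → Fin 2, f (Fin.cons 1 y) := by
  rw [← (Fin.consEquiv fun _ : Fin (n + 1) => Fin 2).sum_comp, Fintype.sum_prod_type,
    Fin.sum_univ_two]
  rfl

theorem sum_filter_head {n : ℕ} {M : Type} [AddCommMonoid M] (f : (Fin (n + 1) → Fin 2) → M)
    (a : Fin 2) :
    ∑ x with x 0 = a, f x = ∑ y : Fin n → Fin 2, f (Fin.cons a y) := by
  rw [Finset.sum_filter, sum_cons_fin_two]
  fin_cases a <;> simp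

/-- The matrix with the blocks `A` and `B` selected by the value of qubit `0`. -/
def blockDiag {n : ℕ} (A B : QMat (Fin n)) : QMat (Fin (n + 1)) :=
  Matrix.of fun x y =>
    if x 0 = y 0 then (if x 0 = 0 then A else B) (Fin.tail x) (Fin.tail y) else 0

/-- The matrix with the block `A` on top of the block `B`, with respect to qubit `0`. -/
def stack {n : ℕ} (A B : QMat (Fin n)) : Matrix (Fin (n + 1) → Fin 2) (Fin n → Fin 2) ℂ :=
  Matrix.of fun x y => (if x 0 = 0 then A else B) (Fin.tail x) y

theorem blockDiag_mul {n : ℕ} (A B C D : QMat (Fin n)) :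
    blockDiag A B * blockDiag C D = blockDiag (A * C) (B * D) := by
  ext x y
  rw [Matrix.mul_apply, sum_cons_fin_two]
  induction x using Fin.consCases with
  | _ a x =>
    induction y using Fin.consCases with
    | _ b y =>
      fin_cases a <;> fin_cases b <;> simp [blockDiag, Matrix.mul_apply]

theorem blockDiag_mul_stack {n : ℕ} (A B C D : QMat (Fin n)) :
    blockDiag A B * stack C D = stack (A * C) (B * D) := by
  ext x y
  rw [Matrix.mul_apply, sum_cons_fin_two]
  induction x using Fin.consCases with
  | _ a x => fin_cases a <;> simp [blockDiag, stack, Matrix.mul_apply]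

theorem onQubit_zero_mul_stack {n : ℕ} (M : Matrix (Fin 2) (Fin 2) ℂ) (C D : QMat (Fin n)) :
    onQubit (0 : Fin (n + 1)) M * stack C D = stack (M 0 0 • C + M 0 1 • D) (M 1 0 • C + M 1 1 • D) := by
  ext x y
  rw [Matrix.mul_apply, sum_cons_fin_two]
  induction x using Fin.consCases with
  | _ a x =>
    have h : ∀ (a b : Fin 2) (x z : Fin n → Fin 2),
        onQubit (0 : Fin (n + 1)) M (Fin.cons a x) (Fin.cons b z) =
          if x = z then M a b else 0 := by
      intro a b x z
      simp only [onQubit, Matrix.of_apply, Fin.forall_fin_succ, Fin.cons_zero, Fin.cons_succ,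
        funext_iff]
      simp
    simp only [h]
    fin_cases a <;> simp [stack]

theorem adjoinAncilla_eq_stack (n : ℕ) : adjoinAncilla n = stack 1 0 := by
  ext x y
  induction x using Fin.consCases with
  | _ a x => fin_cases a <;> simp [adjoinAncilla, stack, Matrix.one_apply, Fin.cons_inj]

theorem PauliString.mat_cons {n : ℕ} (A : Pauli) (P : PauliString n) (a b : Fin 2)
    (x y : Fin n → Fin 2) :
    (PauliString.mat (Fin.cons A P : PauliString (n + 1))) (Fin.cons a x) (Fin.cons b y) =
      A.mat a b * P.mat x y := by
  simp [PauliString.mat, Fin.prod_univ_succ]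

theorem rot_cons_I {n : ℕ} (P : PauliString n) (θ : ℝ) :
    rot (PauliString.mat (Fin.cons .I P : PauliString (n + 1))) θ =
      blockDiag (rot P.mat θ) (rot P.mat θ) := by
  ext x y
  induction x using Fin.consCases with
  | _ a x =>
    induction y using Fin.consCases with
    | _ b y =>
      simp only [rot, blockDiag, Matrix.add_apply, Matrix.smul_apply, PauliString.mat_cons,
        Matrix.of_apply]
      fin_cases a <;> fin_cases b <;> simp [Pauli.mat, Matrix.one_apply, Fin.cons_inj]

theorem rot_cons_Z {n : ℕ} (P : PauliString n) (θ : ℝ) :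
    rot (PauliString.mat (Fin.cons .Z P : PauliString (n + 1))) θ =
      blockDiag (rot P.mat θ) (rot P.mat (-θ)) := by
  ext x y
  induction x using Fin.consCases with
  | _ a x =>
    induction y using Fin.consCases with
    | _ b y =>
      simp only [rot, blockDiag, Matrix.add_apply, Matrix.smul_apply, PauliString.mat_cons,
        Matrix.of_apply]
      fin_cases a <;> fin_cases b <;> simp [Pauli.mat, Matrix.one_apply, Fin.cons_inj]

/-- Pauli rotations controlled by qubit `0` cost two single-qubit rotations. -/
theorem exists_controlled_rot {n : ℕ} (P : PauliString n) (θ : ℝ) :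
    ∃ c : Circuit (Fin (n + 1)), Circuit.mat c = blockDiag 1 (rot P.mat θ) ∧
      Circuit.rotationCount c ≤ 2 := by
  -- The rotations about `I ⊗ P` by `θ/2` and about `Z ⊗ P` by `-θ/2` cancel where the ancilla is
  -- `0` and add up to `θ` where it is `1`.
  obtain ⟨c, hc, hc'⟩ := isRotatable (Fin.cons .I P : PauliString (n + 1)) (θ / 2)
  obtain ⟨d, hd, hd'⟩ := isRotatable (Fin.cons .Z P : PauliString (n + 1)) (-(θ / 2))
  refine ⟨c ++ d, ?_, ?_⟩
  · rw [Circuit.mat_append, hc, hd, rot_cons_I, rot_cons_Z, blockDiag_mul,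
      rot_mul_rot P.mat_mul_self, rot_mul_rot P.mat_mul_self, neg_neg, neg_add_cancel, add_halves,
      rot_zero]
  · rw [Circuit.rotationCount_append]
    omega

/-- A circuit for the controlled rotation by `θ` about a signed Pauli operator. -/
def controlledRot {n : ℕ} (θ : ℝ) (P : Bool × PauliString n) : Circuit (Fin (n + 1)) :=
  (exists_controlled_rot P.2 (if P.1 then -θ else θ)).choose

theorem controlledRot_mat {n : ℕ} (θ : ℝ) (P : Bool × PauliString n) :
    Circuit.mat (controlledRot θ P) = blockDiag 1 (rot P.2.mat (if P.1 then -θ else θ)) :=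
  (exists_controlled_rot P.2 (if P.1 then -θ else θ)).choose_spec.1

theorem controlledRot_rotationCount {n : ℕ} (θ : ℝ) (P : Bool × PauliString n) :
    Circuit.rotationCount (controlledRot θ P) ≤ 2 :=
  (exists_controlled_rot P.2 (if P.1 then -θ else θ)).choose_spec.2

/-! ### The Hadamard test -/

theorem outcomeProb_eq_trace {n : ℕ} (c : Circuit (Fin (n + 1))) (ρ : QState n)
    (A B : QMat (Fin n)) (h : Circuit.mat c * adjoinAncilla n = stack A B) (b : Bool) :
    outcomeProb c ρ b =
      ((if b then B else A) * ρ.mat * (if b then B else A)ᴴ).trace.re := by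
  have hs : ∀ (a : Fin 2) (y : Fin n → Fin 2),
      finalState c ρ (Fin.cons a y) (Fin.cons a y) =
        ((if a = 0 then A else B) * ρ.mat * (if a = 0 then A else B)ᴴ) y y := by
    intro a y
    rw [finalState, h]
    fin_cases a <;> simp [stack, Matrix.mul_apply]
  rw [outcomeProb, sum_filter_head, Matrix.trace, Complex.re_sum]
  refine Finset.sum_congr rfl fun y _ => ?_
  rw [hs]
  cases b <;> simp

/-- The circuit of the Hadamard test for the controlled operation `body`; it measures the real part,
or after the additional phase gate the imaginary part. -/
def hadamardTest {n : ℕ} (q : Bool) (body : Circuit (Fin (n + 1))) : Circuit (Fin (n + 1)) :=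
  .hadamard 0 :: ((if q then [.phase 0] else []) ++ (body ++ [.hadamard 0]))

theorem hadamardTest_mat_mul_adjoinAncilla {n : ℕ} (q : Bool) (body : Circuit (Fin (n + 1)))
    (U : QMat (Fin n)) (h : Circuit.mat body = blockDiag 1 U) :
    Circuit.mat (hadamardTest q body) * adjoinAncilla n =
      stack ((2⁻¹ : ℂ) • (1 + (if q then Complex.I else 1) • U))
        ((2⁻¹ : ℂ) • (1 - (if q then Complex.I else 1) • U)) := by
  have h2 := sqrt_two_inv_mul_self
  rw [hadamardTest, Circuit.mat, Circuit.mat_append, Circuit.mat_append, Circuit.mat_singleton, h,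
    adjoinAncilla_eq_stack]
  cases q
  · simp only [Bool.false_eq_true, if_false, Circuit.mat, Matrix.mul_one, Gate.mat,
      Matrix.mul_assoc, onQubit_zero_mul_stack, blockDiag_mul_stack]
    congr 1 <;>
    · ext x y
      simp
      first
        | linear_combination ((1 : QMat (Fin n)) x y + U x y) * h2
        | linear_combination ((1 : QMat (Fin n)) x y - U x y) * h2
  · simp only [if_true, Circuit.mat_singleton, Gate.mat,
      Matrix.mul_assoc, onQubit_zero_mul_stack, blockDiag_mul_stack]
    congr 1 <;>
    · ext x y
      simp
      first
        | linear_combination ((1 : QMat (Fin n)) x y + Complex.I * U x y) * h2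
        | linear_combination ((1 : QMat (Fin n)) x y - Complex.I * U x y) * h2

/-- The two unnormalized branches are `(1 ± Y)/2` with `Y = U` or `Y = iU`. In the difference of
their probabilities `ρ` and `Y ρ Y†` cancel, and the cross terms leave the real part of `tr(Y ρ)`.
-/
theorem hadamardTest_outcomeProb_sub {n : ℕ} (q : Bool) (body : Circuit (Fin (n + 1)))
    (U : QMat (Fin n)) (h : Circuit.mat body = blockDiag 1 U) (ρ : QState n) :
    outcomeProb (hadamardTest q body) ρ false - outcomeProb (hadamardTest q body) ρ true =
      ((if q then Complex.I else 1) * (ρ.mat * U).trace).re := by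
  have h1 := hadamardTest_mat_mul_adjoinAncilla q body U h
  rw [outcomeProb_eq_trace _ ρ _ _ h1, outcomeProb_eq_trace _ ρ _ _ h1]
  simp only [Bool.false_eq_true, if_false, if_true]
  generalize (if q then Complex.I else (1 : ℂ)) = w
  have hY : (w * (ρ.mat * U).trace) = ((w • U) * ρ.mat).trace := by
    rw [Matrix.smul_mul, Matrix.trace_smul, smul_eq_mul, Matrix.trace_mul_comm]
  rw [hY]
  generalize w • U = Y
  have hρ : ρ.matᴴ = ρ.mat := ρ.posSemidef.isHermitian
  have hc : (ρ.mat * Yᴴ).trace = star (Y * ρ.mat).trace := by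
    rw [← Matrix.trace_conjTranspose, Matrix.conjTranspose_mul, hρ]
  rw [← Complex.sub_re, ← Matrix.trace_sub]
  have hm : (2⁻¹ : ℂ) • (1 + Y) * ρ.mat * ((2⁻¹ : ℂ) • (1 + Y))ᴴ -
      (2⁻¹ : ℂ) • (1 - Y) * ρ.mat * ((2⁻¹ : ℂ) • (1 - Y))ᴴ =
        (2⁻¹ : ℂ) • (Y * ρ.mat + ρ.mat * Yᴴ) := by
    simp only [Matrix.conjTranspose_smul, Matrix.conjTranspose_add, Matrix.conjTranspose_sub,
      Matrix.conjTranspose_one, Matrix.smul_mul, Matrix.mul_smul, Matrix.add_mul, Matrix.sub_mul,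
      Matrix.mul_add, Matrix.mul_sub, Matrix.one_mul, Matrix.mul_one]
    rw [show star (2⁻¹ : ℂ) = 2⁻¹ by simp]
    module
  rw [hm, Matrix.trace_smul, Matrix.trace_add, hc]
  simp
  ring

/-! ### Averaging over compiled circuits -/

/-- The mean of a function of the circuit that results from executing a template. -/
def compileExp {n : ℕ} (H : Hamiltonian n) :
    List (Instruction n) → (Circuit (Fin (n + 1)) → ℝ) → ℝ
  | [], φ => φ []
  | .gate g :: T, φ => compileExp H T fun c => φ (g :: c)
  | .sampled f :: T, φ =>
      ∑ l, |H.coeff l| / H.weight * compileExp H T fun c => φ (f (H.signedTerm l) ++ c)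

theorem tsum_bind_mul {α β : Type} (p : PMF α) (q : α → PMF β) (F : β → ℝ≥0∞) :
    ∑' b, (p.bind q) b * F b = ∑' a, p a * ∑' b, q a b * F b := by
  simp only [PMF.bind_apply, ← ENNReal.tsum_mul_right, ← ENNReal.tsum_mul_left, mul_assoc]
  exact ENNReal.tsum_comm

theorem tsum_map_mul {α β : Type} (p : PMF α) (g : α → β) (F : β → ℝ≥0∞) :
    ∑' b, (p.map g) b * F b = ∑' a, p a * F (g a) := by
  rw [PMF.map, tsum_bind_mul]
  refine tsum_congr fun a => ?_
  rw [tsum_eq_single (g a)]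
  · simp
  · intro b hb
    simp [hb]

theorem compileExp_nonneg {n : ℕ} (H : Hamiltonian n) (T : List (Instruction n))
    (φ : Circuit (Fin (n + 1)) → ℝ) (hφ : ∀ c, 0 ≤ φ c) : 0 ≤ compileExp H T φ := by
  induction T generalizing φ with
  | nil => exact hφ _
  | cons i T ih =>
    cases i with
    | gate g => exact ih _ fun _ => hφ _
    | sampled f =>
      exact Finset.sum_nonneg fun l _ =>
        mul_nonneg (div_nonneg (abs_nonneg _) H.weight_pos.le) (ih _ fun _ => hφ _)

/-- Replaces expectations over the infinite type of circuits by the finite recursion `compileExp`.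
For nonnegative `φ` this takes place in `ℝ≥0∞`, where no summability has to be checked. -/
theorem tsum_compile_mul {n : ℕ} (H : Hamiltonian n) (T : List (Instruction n))
    (φ : Circuit (Fin (n + 1)) → ℝ) (hφ : ∀ c, 0 ≤ φ c) :
    ∑' c, compile H T c * ENNReal.ofReal (φ c) = ENNReal.ofReal (compileExp H T φ) := by
  induction T generalizing φ with
  | nil =>
    rw [compile, tsum_eq_single []]
    · simp [compileExp]
    · intro b hb
      simp [hb]
  | cons i T ih =>
    cases i with
    | gate g =>
      rw [compile, tsum_map_mul, compileExp]
      exact ih _ fun _ => hφ _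
    | sampled f =>
      rw [compile, tsum_bind_mul, tsum_fintype, compileExp, ENNReal.ofReal_sum_of_nonneg]
      · refine Finset.sum_congr rfl fun l _ => ?_
        rw [tsum_map_mul, ih _ fun _ => hφ _, ENNReal.ofReal_mul]
        · rfl
        · exact div_nonneg (abs_nonneg _) H.weight_pos.le
      · exact fun l _ => mul_nonneg (div_nonneg (abs_nonneg _) H.weight_pos.le)
          (compileExp_nonneg H T _ fun _ => hφ _)

theorem compileExp_sub {n : ℕ} (H : Hamiltonian n) (T : List (Instruction n))
    (φ ψ : Circuit (Fin (n + 1)) → ℝ) :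
    compileExp H T (fun c => φ c - ψ c) = compileExp H T φ - compileExp H T ψ := by
  induction T generalizing φ ψ with
  | nil => rfl
  | cons i T ih =>
    cases i with
    | gate g => exact ih _ _
    | sampled f =>
      simp only [compileExp, ih, mul_sub, Finset.sum_sub_distrib]

theorem Circuit.rotationCount_le_of_mem_support_compile {n : ℕ} (H : Hamiltonian n)
    (f : Bool × PauliString n → Circuit (Fin (n + 1)))
    (hf : ∀ P, Circuit.rotationCount (f P) ≤ 2) (g : Gate (Fin (n + 1)))
    (hg : Circuit.rotationCount [g] = 0) (N : ℕ) (c : Circuit (Fin (n + 1)))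
    (hc : c ∈ (compile H (List.replicate N (.sampled f) ++ [.gate g])).support) :
    Circuit.rotationCount c ≤ 2 * N := by
  induction N generalizing c with
  | zero =>
    simp only [List.replicate_zero, List.nil_append, compile, PMF.pure_map, PMF.support_pure,
      Set.mem_singleton_iff] at hc
    subst hc
    omega
  | succ N ih =>
    simp only [List.replicate_succ, List.cons_append, compile, PMF.mem_support_bind_iff,
      PMF.mem_support_map_iff] at hc
    obtain ⟨l, _, d, hd, rfl⟩ := hc
    rw [Circuit.rotationCount_append]
    have := ih d hd
    have := hf (H.signedTerm l)
    omega

/-- The mean of a quantity that depends linearly on a product of independently sampled factors. -/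
theorem compileExp_replicate {n : ℕ} (H : Hamiltonian n)
    (f : Bool × PauliString n → Circuit (Fin (n + 1))) (g : Gate (Fin (n + 1)))
    (U : Bool × PauliString n → QMat (Fin n)) (N : ℕ) (φ : Circuit (Fin (n + 1)) → ℝ)
    (Λ : QMat (Fin n) →ₗ[ℝ] ℝ)
    (h : ∀ ls : List (Bool × PauliString n), ls.length = N →
      φ (ls.flatMap f ++ [g]) = Λ ((ls.map U).reverse.prod)) :
    compileExp H (List.replicate N (.sampled f) ++ [.gate g]) φ =
      Λ ((∑ l, (|H.coeff l| / H.weight) • U (H.signedTerm l)) ^ N) := by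
  induction N generalizing φ Λ with
  | zero => simpa [compileExp] using h [] rfl
  | succ N ih =>
    simp only [List.replicate_succ, List.cons_append, compileExp]
    rw [pow_succ, Finset.mul_sum, map_sum]
    refine Finset.sum_congr rfl fun l _ => ?_
    -- What is drawn first acts first, so its unitary is the rightmost factor. It is absorbed into
    -- the linear functional, which is why the induction generalizes over `Λ`.
    rw [ih (Λ := Λ ∘ₗ LinearMap.mulRight ℝ (U (H.signedTerm l)))]
    · simp
    · intro ls hls
      have := h (H.signedTerm l :: ls) (by simp [hls])
      simpa using this

/-- The mean step of the randomly compiled evolution. -/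
theorem sum_rot_signedTerm {n : ℕ} (H : Hamiltonian n) (θ : ℝ) :
    ∑ l, (|H.coeff l| / H.weight) • rot (H.signedTerm l).2.mat
        (if (H.signedTerm l).1 then -θ else θ) = rot ((H.weight⁻¹ : ℝ) • H.mat) θ := by
  have hw : H.weight ≠ 0 := H.weight_pos.ne'
  -- The sign of the coefficient is carried by the angle: cosine is even and sine is odd, so `|α|
  -- sin(±θ) = α sin θ`.
  have h1 : ∀ l, (|H.coeff l| / H.weight) • rot (H.signedTerm l).2.mat
        (if (H.signedTerm l).1 then -θ else θ) =
      (|H.coeff l| / H.weight) • (((Real.cos θ : ℝ) : ℂ) • (1 : QMat (Fin n))) +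
        (Complex.I * ((Real.sin θ : ℝ) : ℂ)) •
          ((H.weight⁻¹ : ℝ) • ((H.coeff l : ℝ) : ℂ) • (H.term l).mat) := by
    intro l
    have hr : ∀ (r : ℝ) (A : QMat (Fin n)), r • A = (r : ℂ) • A := fun r A => by
      ext x y; simp
    simp only [Hamiltonian.signedTerm, rot, hr, decide_eq_true_eq]
    split_ifs with hneg
    · rw [abs_of_neg hneg, Real.cos_neg, Real.sin_neg, smul_add]
      congr 1
      simp only [smul_smul]
      congr 1
      push_cast
      ring
    · rw [abs_of_nonneg (not_lt.1 hneg), smul_add]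
      congr 1
      simp only [smul_smul]
      congr 1
      push_cast
      ring
  rw [Finset.sum_congr rfl fun l _ => h1 l, Finset.sum_add_distrib, ← Finset.sum_smul,
    ← Finset.sum_div, ← Finset.smul_sum, ← Finset.smul_sum]
  rw [show (∑ l, |H.coeff l|) / H.weight = 1 from div_self hw, one_smul]
  rfl

/-! ### Spectral decomposition -/

namespace Hamiltonian

variable {n : ℕ} (H : Hamiltonian n)

/-- The eigenvalues of a Hamiltonian. -/
def energy (i : Fin n → Fin 2) : ℝ := H.isHermitian.eigenvalues i

theorem groundEnergy_le (i : Fin n → Fin 2) : H.groundEnergy ≤ H.energy i :=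
  ciInf_le (Set.finite_range _).bddBelow i

theorem exists_energy_eq_groundEnergy : ∃ i, H.energy i = H.groundEnergy :=
  exists_eq_ciInf_of_finite

theorem _root_.GroundEnergy.PauliString.conjTranspose_mat (P : PauliString n) : P.matᴴ = P.mat := by
  have hP : ∀ (P : Pauli) (a b : Fin 2), star (P.mat a b) = P.mat b a := by
    intro P a b
    cases P <;> fin_cases a <;> fin_cases b <;> simp [Pauli.mat]
  ext x y
  simp only [Matrix.conjTranspose_apply, PauliString.mat, Matrix.of_apply, star_prod, hP]

/-- An energy is a diagonal entry of `U* H U` for the unitary `U` of eigenvectors. Each conjugated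
Pauli operator is unitary, so its entries have modulus at most `1`. -/
theorem abs_energy_le (i : Fin n → Fin 2) : |H.energy i| ≤ H.weight := by
  set U := H.isHermitian.eigenvectorUnitary with hU
  have h1 : ((H.energy i : ℝ) : ℂ) =
      ∑ l, ((H.coeff l : ℝ) : ℂ) * (star (U : QMat (Fin n)) * (H.term l).mat * U) i i := by
    have h := H.isHermitian.conjStarAlgAut_star_eigenvectorUnitary
    rw [Unitary.conjStarAlgAut_apply] at h
    have h2 := congrFun (congrFun h i) i
    rw [Matrix.diagonal_apply_eq] at h2
    simp only [Function.comp_apply] at h2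
    have h3 : ((H.energy i : ℝ) : ℂ) = (star (U : QMat (Fin n)) * H.mat * U) i i := by
      rw [energy]
      simpa using h2.symm
    rw [h3, Hamiltonian.mat, Finset.mul_sum, Finset.sum_mul, Matrix.sum_apply]
    refine Finset.sum_congr rfl fun l _ => ?_
    rw [Matrix.mul_smul, Matrix.smul_mul, Matrix.smul_apply, smul_eq_mul]
  have h4 : ∀ l, ‖(star (U : QMat (Fin n)) * (H.term l).mat * U) i i‖ ≤ 1 := by
    intro l
    apply entry_norm_bound_of_unitary
    have hP : (H.term l).mat ∈ Matrix.unitaryGroup (Fin n → Fin 2) ℂ := by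
      rw [Matrix.mem_unitaryGroup_iff, Matrix.star_eq_conjTranspose,
        PauliString.conjTranspose_mat, PauliString.mat_mul_self]
    exact mul_mem (mul_mem (star U).2 hP) U.2
  calc |H.energy i| = ‖((H.energy i : ℝ) : ℂ)‖ := by rw [Complex.norm_real, Real.norm_eq_abs]
    _ ≤ ∑ l, ‖((H.coeff l : ℝ) : ℂ) * (star (U : QMat (Fin n)) * (H.term l).mat * U) i i‖ := by
        rw [h1]; exact norm_sum_le _ _
    _ ≤ ∑ l, |H.coeff l| := by
        refine Finset.sum_le_sum fun l _ => ?_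
        rw [norm_mul, Complex.norm_real, Real.norm_eq_abs]
        exact mul_le_of_le_one_right (abs_nonneg _) (h4 l)

theorem abs_groundEnergy_le : |H.groundEnergy| ≤ H.weight := by
  obtain ⟨i, hi⟩ := H.exists_energy_eq_groundEnergy
  rw [← hi]
  exact H.abs_energy_le i

/-- The distribution of the energy in a state. -/
theorem exists_energy_distribution (ρ : QState n) :
    ∃ w : (Fin n → Fin 2) → ℝ, (∀ i, 0 ≤ w i) ∧ ∑ i, w i = 1 ∧
      H.overlap ρ = ∑ i with H.energy i = H.groundEnergy, w i ∧
      ∀ (θ : ℝ) (N : ℕ), (ρ.mat * rot ((H.weight⁻¹ : ℝ) • H.mat) θ ^ N).trace =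
        ∑ i, (w i : ℂ) * (((Real.cos θ : ℝ) : ℂ) + Complex.I * ((Real.sin θ : ℝ) : ℂ) *
          ((H.energy i / H.weight : ℝ) : ℂ)) ^ N := by
  set U := H.isHermitian.eigenvectorUnitary with hU
  set f := Unitary.conjStarAlgAut ℂ (QMat (Fin n)) U with hf
  have hpsd : (star (U : QMat (Fin n)) * ρ.mat * U).PosSemidef :=
    ρ.posSemidef.conjTranspose_mul_mul_same _
  have hw : ∀ i, (((star (U : QMat (Fin n)) * ρ.mat * U) i i).re : ℂ) =
      (star (U : QMat (Fin n)) * ρ.mat * U) i i := by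
    intro i
    have h := (Complex.le_def.1 (hpsd.diag_nonneg (i := i))).2
    exact Complex.ext (by simp) (by simpa using h)
  have htr : ∀ D : (Fin n → Fin 2) → ℂ, (ρ.mat * f (Matrix.diagonal D)).trace =
      ∑ i, (((star (U : QMat (Fin n)) * ρ.mat * U) i i).re : ℂ) * D i := by
    intro D
    rw [hf, Unitary.conjStarAlgAut_apply, ← Matrix.mul_assoc, Matrix.trace_mul_comm,
      ← Matrix.mul_assoc, ← Matrix.mul_assoc, Matrix.trace]
    refine Finset.sum_congr rfl fun i _ => ?_
    rw [hw, Matrix.diag_apply, Matrix.mul_diagonal]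
  -- The weights are the populations of `ρ` in an eigenbasis of the Hamiltonian.
  refine ⟨fun i => ((star (U : QMat (Fin n)) * ρ.mat * U) i i).re, ?_, ?_, ?_, ?_⟩
  · exact fun i => (Complex.le_def.1 (hpsd.diag_nonneg (i := i))).1
  · have h := htr 1
    rw [show Matrix.diagonal (1 : (Fin n → Fin 2) → ℂ) = 1 from Matrix.diagonal_one, map_one,
      mul_one, ρ.trace_eq_one] at h
    have := congrArg Complex.re h
    simpa using this.symm
  · rw [overlap, groundProjection, Matrix.IsHermitian.cfc, htr, Complex.re_sum,
      Finset.sum_filter]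
    refine Finset.sum_congr rfl fun i _ => ?_
    by_cases h : H.energy i = H.groundEnergy
    · have h' : H.isHermitian.eigenvalues i = H.groundEnergy := h
      simp [h, h']
    · have h' : ¬ H.isHermitian.eigenvalues i = H.groundEnergy := h
      simp [h, h']
  · intro θ N
    have hH : H.mat = f (Matrix.diagonal fun i => ((H.energy i : ℝ) : ℂ)) :=
      H.isHermitian.spectral_theorem
    have hr : rot ((H.weight⁻¹ : ℝ) • H.mat) θ = f (Matrix.diagonal fun i =>
        (((Real.cos θ : ℝ) : ℂ) + Complex.I * ((Real.sin θ : ℝ) : ℂ) *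
          ((H.energy i / H.weight : ℝ) : ℂ))) := by
      have hr : ∀ (r : ℝ) (A : QMat (Fin n)), r • A = (r : ℂ) • A := fun r A => by
        ext x y; simp
      have h1 : (1 : QMat (Fin n)) = f 1 := (map_one f).symm
      rw [rot, hr, hH, h1, ← map_smul, ← map_smul, ← map_smul, ← map_add]
      congr 1
      ext x y
      by_cases hxy : x = y
      · subst hxy
        simp
        left
        ring
      · simp [hxy]
    rw [hr, ← map_pow, Matrix.diagonal_pow, htr]
    simp

end Hamiltonian

/-! ### Trigonometric polynomials -/

theorem exists_coeff_geom_sum_pow (m p : ℕ) :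
    ∃ c : ℕ → ℝ, ∀ z : ℂ, (∑ a ∈ Finset.range m, z ^ a) ^ p =
      ∑ a ∈ Finset.range (p * m + 1), (c a : ℂ) * z ^ a := by
  set P : Polynomial ℝ := (∑ a ∈ Finset.range m, Polynomial.X ^ a) ^ p with hP
  have hdeg : P.natDegree < p * m + 1 := by
    refine Nat.lt_succ_of_le (Polynomial.natDegree_pow_le.trans (Nat.mul_le_mul_left p ?_))
    refine Polynomial.natDegree_sum_le_of_forall_le _ _ fun a ha => ?_
    rw [Polynomial.natDegree_X_pow]
    exact (Finset.mem_range.1 ha).le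
  refine ⟨P.coeff, fun z => ?_⟩
  have h := Polynomial.aeval_eq_sum_range' hdeg z
  rw [hP, map_pow, map_sum] at h
  simpa using h

/-- The squared modulus of the trigonometric polynomial with coefficients `c a`, `a < n`. -/
def trigSq (c : ℕ → ℝ) (n : ℕ) (u : ℝ) : ℝ :=
  ∑ a ∈ Finset.range n, ∑ b ∈ Finset.range n, c a * c b * Real.cos (((a : ℤ) - b : ℤ) * u)

theorem norm_sq_sum_exp (c : ℕ → ℝ) (n : ℕ) (u : ℝ) :
    ‖∑ a ∈ Finset.range n, (c a : ℂ) * Complex.exp (u * Complex.I) ^ a‖ ^ 2 = trigSq c n u := by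
  have h : ∀ a : ℕ, (c a : ℂ) * Complex.exp (u * Complex.I) ^ a =
      ((c a * Real.cos (a * u) : ℝ) : ℂ) + ((c a * Real.sin (a * u) : ℝ) : ℂ) * Complex.I := by
    intro a
    rw [← Complex.exp_nat_mul, ← mul_assoc, Complex.exp_mul_I]
    push_cast
    ring
  rw [← Complex.normSq_eq_norm_sq, Finset.sum_congr rfl fun a _ => h a, Finset.sum_add_distrib,
    ← Finset.sum_mul, ← Complex.ofReal_sum, ← Complex.ofReal_sum, Complex.normSq_add_mul_I, sq, sq,
    Finset.sum_mul_sum, Finset.sum_mul_sum, ← Finset.sum_add_distrib]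
  refine Finset.sum_congr rfl fun a _ => ?_
  rw [← Finset.sum_add_distrib]
  refine Finset.sum_congr rfl fun b _ => ?_
  push_cast
  rw [sub_mul, Real.cos_sub]
  ring

theorem continuous_trigSq (c : ℕ → ℝ) (n : ℕ) : Continuous (trigSq c n) := by
  unfold trigSq
  fun_prop

theorem integral_trigSq (c : ℕ → ℝ) (n : ℕ) (x y : ℝ) :
    ∫ u in x..y, trigSq c n u = ∑ a ∈ Finset.range n, ∑ b ∈ Finset.range n,
      c a * c b * ∫ u in x..y, Real.cos (((a : ℤ) - b : ℤ) * u) := by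
  unfold trigSq
  rw [intervalIntegral.integral_finsetSum]
  · refine Finset.sum_congr rfl fun a _ => ?_
    rw [intervalIntegral.integral_finsetSum]
    · refine Finset.sum_congr rfl fun b _ => ?_
      rw [intervalIntegral.integral_const_mul]
    · exact fun b _ => Continuous.intervalIntegrable (by fun_prop) _ _
  · exact fun a _ => Continuous.intervalIntegrable (by fun_prop) _ _

theorem integral_cos_int_mul (k : ℤ) (hk : k ≠ 0) (x y : ℝ) :
    ∫ u in x..y, Real.cos (k * u) = (Real.sin (k * y) - Real.sin (k * x)) / k := by
  have hk' : (k : ℝ) ≠ 0 := by exact_mod_cast hk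
  rw [intervalIntegral.integral_comp_mul_left (fun u => Real.cos u) hk', integral_cos, smul_eq_mul,
    inv_mul_eq_div]

/-- Parseval's identity: over a full period only the diagonal terms survive. -/
theorem integral_trigSq_period (c : ℕ → ℝ) (n : ℕ) :
    ∫ u in (-Real.pi)..Real.pi, trigSq c n u =
      2 * Real.pi * ∑ a ∈ Finset.range n, c a ^ 2 := by
  rw [integral_trigSq, Finset.mul_sum]
  refine Finset.sum_congr rfl fun a ha => ?_
  rw [Finset.sum_eq_single a]
  · simp
    ring
  · intro b _ hb
    rw [integral_cos_int_mul _ (by omega), mul_neg, Real.sin_neg, Real.sin_int_mul_pi]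
    simp
  · exact fun h => absurd ha h

/-- The Fourier coefficients of the indicator function of a quarter of the circle. -/
def quarterCoeff (k : ℤ) : ℂ :=
  if k = 0 then ((Real.pi / 2 : ℝ) : ℂ)
  else (1 - Complex.exp (((-(k * (Real.pi / 2)) : ℝ) : ℂ) * Complex.I)) / (k * Complex.I)

theorem norm_quarterCoeff_le (k : ℤ) : ‖quarterCoeff k‖ ≤ 4 / (1 + |(k : ℝ)|) := by
  unfold quarterCoeff
  split_ifs with hk
  · subst hk
    rw [Complex.norm_real, Real.norm_of_nonneg (by positivity)]
    have := Real.pi_le_four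
    norm_num
    linarith
  · have hk1 : (1 : ℝ) ≤ |(k : ℝ)| := by
      exact_mod_cast Int.one_le_abs hk
    have h2 : ‖(1 : ℂ) - Complex.exp (((-(k * (Real.pi / 2)) : ℝ) : ℂ) * Complex.I)‖ ≤ 2 := by
      refine (norm_sub_le _ _).trans ?_
      rw [Complex.norm_exp_ofReal_mul_I, norm_one]
      norm_num
    rw [norm_div, norm_mul, Complex.norm_I, mul_one, Complex.norm_intCast,
      div_le_div_iff₀ (by linarith) (by linarith)]
    nlinarith

/-- `quarterCoeff k` is the integral of `exp(iku)` over `[-π/2, 0]`; translating the window by `y`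
multiplies it by a phase. -/
theorem integral_cos_quarter (k : ℤ) (y : ℝ) :
    ∫ u in (y - Real.pi / 2)..y, Real.cos (k * u) =
      (quarterCoeff k * Complex.exp (((k * y : ℝ) : ℂ) * Complex.I)).re := by
  unfold quarterCoeff
  split_ifs with hk
  · subst hk
    simp
  · have hk' : (k : ℝ) ≠ 0 := by exact_mod_cast hk
    rw [integral_cos_int_mul k hk, div_mul_eq_mul_div, sub_mul, one_mul, ← Complex.exp_add,
      ← add_mul, ← Complex.ofReal_add, show -(k * (Real.pi / 2)) + k * y = k * (y - Real.pi / 2) by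
        ring]
    have : (Complex.exp (((k * y : ℝ) : ℂ) * Complex.I) -
        Complex.exp (((k * (y - Real.pi / 2) : ℝ) : ℂ) * Complex.I)) / (k * Complex.I) =
        ((k : ℝ) : ℂ)⁻¹ * (-Complex.I * (Complex.exp (((k * y : ℝ) : ℂ) * Complex.I) -
        Complex.exp (((k * (y - Real.pi / 2) : ℝ) : ℂ) * Complex.I))) := by
      rw [div_eq_mul_inv, mul_inv, Complex.inv_I]
      push_cast
      ring
    rw [this, ← Complex.ofReal_inv, Complex.re_ofReal_mul]
    have hre : ∀ z : ℂ, (-Complex.I * z).re = z.im := fun z => by simp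
    rw [hre, Complex.sub_im, Complex.exp_ofReal_mul_I_im, Complex.exp_ofReal_mul_I_im]
    field_simp

theorem sum_inv_one_add_abs_sub_le {n a : ℕ} (ha : a < n) :
    ∑ b ∈ Finset.range n, 4 / (1 + |(((a : ℤ) - b : ℤ) : ℝ)|) ≤ 8 * (1 + Real.log n) := by
  have hH : ∑ k ∈ Finset.range n, 1 / ((k : ℝ) + 1) ≤ 1 + Real.log n := by
    have h := harmonic_le_one_add_log n
    rw [harmonic] at h
    push_cast at h
    simpa [one_div] using h
  have hmono : ∀ m ≤ n, ∑ k ∈ Finset.range m, 1 / ((k : ℝ) + 1) ≤ 1 + Real.log n := fun m hm =>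
    (Finset.sum_le_sum_of_subset_of_nonneg (Finset.range_mono hm)
      fun _ _ _ => by positivity).trans hH
  rw [← Finset.sum_range_add_sum_Ico _ ha.le]
  have h1 : ∑ b ∈ Finset.range a, 4 / (1 + |(((a : ℤ) - b : ℤ) : ℝ)|) ≤ 4 * (1 + Real.log n) := by
    rw [← Finset.sum_range_reflect]
    refine le_trans ?_ (mul_le_mul_of_nonneg_left (hmono a ha.le) (by norm_num))
    rw [Finset.mul_sum]
    refine Finset.sum_le_sum fun j hj => ?_
    have hj' := Finset.mem_range.1 hj
    have : (((a : ℤ) - ((a - 1 - j : ℕ) : ℤ) : ℤ) : ℝ) = j + 1 := by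
      have : ((a : ℤ) - ((a - 1 - j : ℕ) : ℤ) : ℤ) = j + 1 := by omega
      rw [this]
      push_cast
      ring
    rw [this, abs_of_nonneg (by positivity), mul_one_div]
    exact div_le_div_of_nonneg_left (by norm_num) (by positivity) (by linarith)
  have h2 : ∑ b ∈ Finset.Ico a n, 4 / (1 + |(((a : ℤ) - b : ℤ) : ℝ)|) ≤
      4 * (1 + Real.log n) := by
    rw [Finset.sum_Ico_eq_sum_range]
    refine le_trans ?_ (mul_le_mul_of_nonneg_left (hmono (n - a) (by omega)) (by norm_num))
    rw [Finset.mul_sum]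
    refine Finset.sum_le_sum fun j _ => ?_
    have : (((a : ℤ) - ((a + j : ℕ) : ℤ) : ℤ) : ℝ) = -(j : ℝ) := by
      push_cast
      ring
    rw [this, abs_neg, abs_of_nonneg (by positivity), mul_one_div, add_comm]
  linarith

/-- Schur test: `|c a * c b|` is at most the mean of the squares, and the `1/(1 + |a - b|)` decay
makes every row sum logarithmic. This keeps the sampling overhead of the filter logarithmic in its
degree. -/
theorem sum_mul_norm_quarterCoeff_le (c : ℕ → ℝ) (n : ℕ) :
    ∑ a ∈ Finset.range n, ∑ b ∈ Finset.range n, ‖((c a * c b : ℝ) : ℂ) * quarterCoeff (a - b)‖ ≤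
      8 * (1 + Real.log n) * ∑ a ∈ Finset.range n, c a ^ 2 := by
  set g : ℕ → ℕ → ℝ := fun a b => 4 / (1 + |(((a : ℤ) - b : ℤ) : ℝ)|) with hg
  have hg0 : ∀ a b, 0 ≤ g a b := fun a b => by positivity
  have hgs : ∀ a b, g a b = g b a := fun a b => by
    simp only [hg]
    push_cast
    rw [abs_sub_comm]
  have hS : ∑ a ∈ Finset.range n, ∑ b ∈ Finset.range n, c a ^ 2 * g a b ≤
      8 * (1 + Real.log n) * ∑ a ∈ Finset.range n, c a ^ 2 := by
    rw [Finset.mul_sum]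
    refine Finset.sum_le_sum fun a ha => ?_
    rw [← Finset.mul_sum, mul_comm]
    exact mul_le_mul_of_nonneg_right (sum_inv_one_add_abs_sub_le (Finset.mem_range.1 ha))
      (sq_nonneg _)
  have hS' : ∑ a ∈ Finset.range n, ∑ b ∈ Finset.range n, c b ^ 2 * g a b =
      ∑ a ∈ Finset.range n, ∑ b ∈ Finset.range n, c a ^ 2 * g a b := by
    rw [Finset.sum_comm]
    simp only [hgs]
  calc _ ≤ ∑ a ∈ Finset.range n, ∑ b ∈ Finset.range n,
        (c a ^ 2 * g a b / 2 + c b ^ 2 * g a b / 2) := by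
        refine Finset.sum_le_sum fun a _ => Finset.sum_le_sum fun b _ => ?_
        rw [norm_mul, Complex.norm_real, Real.norm_eq_abs]
        have h1 : |c a * c b| ≤ (c a ^ 2 + c b ^ 2) / 2 :=
          abs_le.2 ⟨by nlinarith [sq_nonneg (c a + c b)], by nlinarith [sq_nonneg (c a - c b)]⟩
        calc _ ≤ (c a ^ 2 + c b ^ 2) / 2 * g a b :=
              mul_le_mul h1 (norm_quarterCoeff_le _) (norm_nonneg _) (by positivity)
          _ = _ := by ring
    _ = ∑ a ∈ Finset.range n, ∑ b ∈ Finset.range n, c a ^ 2 * g a b := by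
        simp only [Finset.sum_add_distrib, ← Finset.sum_div, hS']
        ring
    _ ≤ _ := hS

/-! ### A power of the Dirichlet kernel -/

/-- The squared modulus of the Dirichlet-type sum `∑ a < m, exp (i a u)`. -/
def fejer (m : ℕ) (u : ℝ) : ℝ := ‖∑ a ∈ Finset.range m, Complex.exp (u * Complex.I) ^ a‖ ^ 2

theorem fejer_eq_trigSq (m : ℕ) : fejer m = trigSq (fun _ => 1) m := by
  funext u
  rw [← norm_sq_sum_exp]
  simp [fejer]

theorem fejer_nonneg (m : ℕ) (u : ℝ) : 0 ≤ fejer m u := by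
  unfold fejer
  positivity

theorem continuous_fejer (m : ℕ) : Continuous (fejer m) :=
  fejer_eq_trigSq m ▸ continuous_trigSq _ _

theorem integral_fejer (m : ℕ) : ∫ u in (-Real.pi)..Real.pi, fejer m u = 2 * Real.pi * m := by
  rw [fejer_eq_trigSq, integral_trigSq_period]
  simp

/-- Geometric sum: the numerator is at most `2`, and Jordan's inequality bounds the denominator `2
|sin(u/2)|` below by `2δ/π`. -/
theorem fejer_le {m : ℕ} {δ u : ℝ} (hδ : 0 < δ) (h1 : δ ≤ |u|) (h2 : |u| ≤ Real.pi) :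
    fejer m u ≤ (Real.pi / δ) ^ 2 := by
  have hg := geom_sum_mul (Complex.exp (u * Complex.I)) m
  have hn := congrArg norm hg
  rw [norm_mul] at hn
  have hle : ‖Complex.exp (u * Complex.I) ^ m - 1‖ ≤ 2 := by
    refine (norm_sub_le _ _).trans ?_
    rw [norm_pow, Complex.norm_exp_ofReal_mul_I, norm_one]
    norm_num
  have hs : 2 / Real.pi * δ ≤ ‖Complex.exp (u * Complex.I) - 1‖ := by
    rw [mul_comm (u : ℂ), Complex.norm_exp_I_mul_ofReal_sub_one, norm_mul, Real.norm_eq_abs,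
      Real.norm_eq_abs]
    have := Real.mul_abs_le_abs_sin (x := u / 2) (by
      rw [abs_div, abs_two]
      linarith)
    rw [abs_div] at this
    rw [abs_two] at this ⊢
    have h3 : 2 / Real.pi * δ ≤ 2 / Real.pi * |u| :=
      mul_le_mul_of_nonneg_left h1 (by positivity)
    linarith
  have hpos : 0 < 2 / Real.pi * δ := by positivity
  have hD : ‖∑ a ∈ Finset.range m, Complex.exp (u * Complex.I) ^ a‖ ≤ Real.pi / δ := by
    have h4 : ‖∑ a ∈ Finset.range m, Complex.exp (u * Complex.I) ^ a‖ * (2 / Real.pi * δ) ≤ 2 :=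
      (mul_le_mul_of_nonneg_left hs (norm_nonneg _)).trans (hn.le.trans hle)
    rw [← le_div_iff₀ hpos] at h4
    refine h4.trans_eq ?_
    field_simp
  exact pow_le_pow_left₀ (norm_nonneg _) hD 2

/-- For `|u| m ≤ 1` no summand has rotated by more than one radian, so each has real part at least
`1/2`. -/
theorem le_fejer {m : ℕ} {u : ℝ} (h : |u| * m ≤ 1) : ((m : ℝ) / 2) ^ 2 ≤ fejer m u := by
  refine pow_le_pow_left₀ (by positivity) ?_ 2
  refine le_trans ?_ (Complex.re_le_norm _)
  rw [Complex.re_sum]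
  calc (m : ℝ) / 2 = ∑ _a ∈ Finset.range m, (1 / 2 : ℝ) := by
        rw [Finset.sum_const, Finset.card_range, nsmul_eq_mul]
        ring
    _ ≤ _ := Finset.sum_le_sum fun a ha => by
        rw [← Complex.exp_nat_mul, ← mul_assoc]
        have : ((a : ℂ) * u) = ((a * u : ℝ) : ℂ) := by push_cast; rfl
        rw [this, Complex.exp_ofReal_mul_I_re]
        have h1 : |(a : ℝ) * u| ≤ 1 := by
          rw [abs_mul, Nat.abs_cast, mul_comm]
          refine le_trans (mul_le_mul_of_nonneg_left ?_ (abs_nonneg u)) h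
          exact_mod_cast (Finset.mem_range.1 ha).le
        have h2 := Real.one_sub_sq_div_two_le_cos (x := a * u)
        have h3 : ((a : ℝ) * u) ^ 2 ≤ 1 := (sq_le_one_iff_abs_le_one _).2 h1
        linarith

theorem one_le_plog {x : ℝ} (hx : 0 ≤ x) : 1 ≤ plog x := by
  rw [plog, Real.le_log_iff_exp_le (by positivity)]
  linarith

theorem exp_neg_plog_le {η : ℝ} (hη : 0 < η) : Real.exp (-plog (1 / η)) ≤ η := by
  rw [plog, Real.exp_neg, Real.exp_log (by positivity)]
  refine inv_le_of_inv_le₀ hη ?_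
  rw [one_div]
  linarith [Real.exp_pos 1]

/-- Mass of the kernel `fejer m ^ (q + 1)` away from the origin. -/
theorem integral_fejer_pow_le {m q : ℕ} {δ x y : ℝ} (hδ : 0 < δ) (hxy : x ≤ y)
    (hx : -Real.pi ≤ x) (hy : y ≤ Real.pi) (h : ∀ u ∈ Set.Icc x y, δ ≤ |u|) :
    ∫ u in x..y, fejer m u ^ (q + 1) ≤ (Real.pi / δ) ^ (2 * q) * (2 * Real.pi * m) := by
  have hc := continuous_fejer m
  calc ∫ u in x..y, fejer m u ^ (q + 1)
      ≤ ∫ u in x..y, (Real.pi / δ) ^ (2 * q) * fejer m u := by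
        refine intervalIntegral.integral_mono_on hxy
          (Continuous.intervalIntegrable (by fun_prop) _ _)
          (Continuous.intervalIntegrable (by fun_prop) _ _) fun u hu => ?_
        -- One factor is kept to be integrated over the whole period; the other `q` are bounded
        -- pointwise.
        rw [pow_succ, pow_mul]
        refine mul_le_mul_of_nonneg_right (pow_le_pow_left₀ (fejer_nonneg m u) ?_ q)
          (fejer_nonneg m u)
        exact fejer_le hδ (h u hu) (abs_le.2 ⟨hx.trans hu.1, hu.2.trans hy⟩)
    _ = (Real.pi / δ) ^ (2 * q) * ∫ u in x..y, fejer m u := by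
        rw [intervalIntegral.integral_const_mul]
    _ ≤ (Real.pi / δ) ^ (2 * q) * ∫ u in (-Real.pi)..Real.pi, fejer m u := by
        refine mul_le_mul_of_nonneg_left ?_ (by positivity)
        exact intervalIntegral.integral_mono_interval hx hxy hy
          (Filter.Eventually.of_forall fejer_nonneg_apply)
          (hc.intervalIntegrable _ _)
    _ = _ := by rw [integral_fejer]
where
  fejer_nonneg_apply : ∀ u, (0 : ℝ → ℝ) u ≤ fejer m u := fun u => fejer_nonneg m u

/-- Mass of the kernel `fejer m ^ (q + 1)` near the origin. -/
theorem le_integral_fejer_pow {m q : ℕ} {δ : ℝ} (hm : 0 < m) (h : 1 / (m : ℝ) ≤ δ) :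
    ((m : ℝ) / 2) ^ (2 * q) * ((m : ℝ) / 2) ≤ ∫ u in (-δ)..δ, fejer m u ^ (q + 1) := by
  have hm' : (0 : ℝ) < m := by exact_mod_cast hm
  have hc := continuous_fejer m
  have h0 : 0 < 1 / (m : ℝ) := by positivity
  calc ((m : ℝ) / 2) ^ (2 * q) * ((m : ℝ) / 2)
      = ∫ _u in (-(1 / (m : ℝ)))..(1 / (m : ℝ)), (((m : ℝ) / 2) ^ 2) ^ (q + 1) := by
        rw [intervalIntegral.integral_const, smul_eq_mul, pow_succ, pow_mul]
        field_simp
        ring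
    _ ≤ ∫ u in (-(1 / (m : ℝ)))..(1 / (m : ℝ)), fejer m u ^ (q + 1) := by
        refine intervalIntegral.integral_mono_on (by linarith)
          (Continuous.intervalIntegrable (by fun_prop) _ _)
          (Continuous.intervalIntegrable (by fun_prop) _ _) fun u hu => ?_
        refine pow_le_pow_left₀ (by positivity) (le_fejer ?_) _
        rw [← le_div_iff₀ hm']
        exact abs_le.2 hu
    _ ≤ _ := by
        refine intervalIntegral.integral_mono_interval (by linarith) (by linarith) h
          (Filter.Eventually.of_forall fun u => ?_)
          (Continuous.intervalIntegrable (by fun_prop) _ _)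
        exact pow_nonneg (fejer_nonneg m u) _

/-- Compares the tail bound with the central mass. As `π² < 10` and `m/2 ≥ 10/δ`, each of the `q`
factors gains `1/10 ≤ exp(-2)`. The choice of `q` makes the total gain beat both `η` and the
constant `32π = 8 · 4π`. -/
theorem tail_factor_le {δ η : ℝ} (hδ : 0 < δ) (hη : 0 < η) {m q : ℕ} (hm : 20 / δ ≤ m)
    (hq : plog (1 / η) + 3 ≤ q) :
    (Real.pi / δ) ^ (2 * q) * (2 * Real.pi * m) ≤
      η / 8 * (((m : ℝ) / 2) ^ (2 * q) * ((m : ℝ) / 2)) := by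
  have hπ := Real.pi_gt_three
  have hπ' := Real.pi_lt_d2
  have hm0 : (0 : ℝ) < m := lt_of_lt_of_le (by positivity) hm
  have h1 : (Real.pi / δ) ^ 2 ≤ 1 / 10 * ((m : ℝ) / 2) ^ 2 := by
    have h2 : (10 / δ) ^ 2 ≤ ((m : ℝ) / 2) ^ 2 :=
      pow_le_pow_left₀ (by positivity) (by
        have : 20 / δ = 10 / δ * 2 := by ring
        linarith) 2
    have h3 : (Real.pi / δ) ^ 2 ≤ 1 / 10 * (10 / δ) ^ 2 := by
      rw [div_pow, div_pow, ← mul_div_assoc]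
      refine div_le_div_of_nonneg_right ?_ (by positivity)
      nlinarith
    linarith
  have h2 : (1 / 10 : ℝ) ^ q * (32 * Real.pi) ≤ η := by
    have h10 : (1 / 10 : ℝ) ≤ Real.exp (-2) := by
      rw [Real.exp_neg, one_div]
      refine inv_anti₀ (Real.exp_pos _) ?_
      have h := Real.exp_one_lt_d9
      have : Real.exp 2 = Real.exp 1 * Real.exp 1 := by rw [← Real.exp_add]; norm_num
      rw [this]
      nlinarith [Real.exp_pos 1]
    have hexp : (1 / 10 : ℝ) ^ q ≤ Real.exp (-plog (1 / η)) * Real.exp (-6) := by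
      calc (1 / 10 : ℝ) ^ q ≤ Real.exp (-2) ^ q := pow_le_pow_left₀ (by norm_num) h10 q
        _ = Real.exp (q * (-2)) := by rw [Real.exp_nat_mul]
        _ ≤ _ := by
          rw [← Real.exp_add, Real.exp_le_exp]
          have := one_le_plog (x := 1 / η) (by positivity)
          linarith
    have h6 : Real.exp (-6) * (32 * Real.pi) ≤ 1 := by
      have h : (2 : ℝ) ^ 6 * 2 ≤ Real.exp 6 := by
        have h1 := Real.exp_one_gt_d9
        have : Real.exp 6 = Real.exp 1 ^ 6 := by rw [← Real.exp_nat_mul]; norm_num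
        rw [this]
        calc (2 : ℝ) ^ 6 * 2 ≤ (2.7 : ℝ) ^ 6 := by norm_num
          _ ≤ _ := pow_le_pow_left₀ (by norm_num) (by linarith) 6
      rw [Real.exp_neg, inv_mul_le_iff₀ (Real.exp_pos _)]
      linarith
    calc (1 / 10 : ℝ) ^ q * (32 * Real.pi)
        ≤ Real.exp (-plog (1 / η)) * Real.exp (-6) * (32 * Real.pi) :=
          mul_le_mul_of_nonneg_right hexp (by positivity)
      _ = Real.exp (-plog (1 / η)) * (Real.exp (-6) * (32 * Real.pi)) := by ring
      _ ≤ η * 1 := mul_le_mul (exp_neg_plog_le hη) h6 (by positivity) hη.le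
      _ = η := mul_one η
  have h3 : (Real.pi / δ) ^ (2 * q) ≤ (1 / 10) ^ q * ((m : ℝ) / 2) ^ (2 * q) := by
    rw [pow_mul, pow_mul ((m : ℝ) / 2), ← mul_pow]
    exact pow_le_pow_left₀ (by positivity) h1 q
  calc (Real.pi / δ) ^ (2 * q) * (2 * Real.pi * m)
      ≤ (1 / 10) ^ q * ((m : ℝ) / 2) ^ (2 * q) * (2 * Real.pi * m) :=
        mul_le_mul_of_nonneg_right h3 (by positivity)
    _ = (1 / 10) ^ q * (32 * Real.pi) * (1 / 8 * (((m : ℝ) / 2) ^ (2 * q) * ((m : ℝ) / 2))) := by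
        ring
    _ ≤ η * (1 / 8 * (((m : ℝ) / 2) ^ (2 * q) * ((m : ℝ) / 2))) :=
        mul_le_mul_of_nonneg_right h2 (by positivity)
    _ = _ := by ring

/-- A trigonometric polynomial of degree `O(Log (1 / η) / δ)` and logarithmic weight that separates
`[δ, 1]` from `[-1, -δ]`. -/
theorem exists_step_filter {δ η : ℝ} (hδ : 0 < δ) (hδ' : δ ≤ 1 / 2) (hη : 0 < η) (hη' : η ≤ 1) :
    ∃ (d : ℕ) (ι : Type) (_ : Fintype ι) (F : ι → ℂ) (j : ι → ℤ),
      plog (1 / η) ≤ d ∧ (d : ℝ) ≤ 126 * (plog (1 / η) / δ) ∧ (∀ a, |j a| ≤ d) ∧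
      ∑ a, ‖F a‖ ≤ 16 * (1 + Real.log d) ∧
      (∀ y : ℝ, 0 ≤ ∑ a, (F a * Complex.exp (((j a * y : ℝ) : ℂ) * Complex.I)).re) ∧
      (∀ y : ℝ, δ ≤ y → y ≤ 1 →
        1 ≤ ∑ a, (F a * Complex.exp (((j a * y : ℝ) : ℂ) * Complex.I)).re) ∧
      (∀ y : ℝ, -1 ≤ y → y ≤ -δ →
        ∑ a, (F a * Complex.exp (((j a * y : ℝ) : ℂ) * Complex.I)).re ≤ η / 4) := by
  have hπ := Real.pi_gt_three
  have hπ' := Real.pi_lt_d2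
  have hpl : 1 ≤ plog (1 / η) := one_le_plog (by positivity)
  set m := ⌈20 / δ⌉₊ with hm
  set q := ⌈plog (1 / η)⌉₊ + 3 with hq
  have hm20 : 20 / δ ≤ m := Nat.le_ceil _
  have hm21 : (m : ℝ) ≤ 21 / δ := by
    have h1 := (Nat.ceil_lt_add_one (show 0 ≤ 20 / δ by positivity)).le
    have h2 : 1 ≤ 1 / δ := by rw [le_div_iff₀ hδ]; linarith
    calc (m : ℝ) ≤ 20 / δ + 1 := h1
      _ ≤ 20 / δ + 1 / δ := by linarith
      _ = 21 / δ := by ring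
  have hq3 : plog (1 / η) + 3 ≤ q := by
    rw [hq]
    push_cast
    linarith [Nat.le_ceil (plog (1 / η))]
  have hq6 : (q : ℝ) + 1 ≤ 6 * plog (1 / η) := by
    have := (Nat.ceil_lt_add_one (show 0 ≤ plog (1 / η) by linarith)).le
    rw [hq]
    push_cast
    linarith
  have hm40 : (40 : ℝ) ≤ m := le_trans (by rw [le_div_iff₀ hδ]; linarith) hm20
  have hm0 : 0 < m := by
    have : (0 : ℝ) < m := by linarith
    exact_mod_cast this
  have hmδ : 1 / (m : ℝ) ≤ δ := by
    rw [div_le_iff₀ (by linarith)]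
    have := (div_le_iff₀ hδ).1 hm20
    linarith
  obtain ⟨c, hc⟩ := exists_coeff_geom_sum_pow m (q + 1)
  set n := (q + 1) * m + 1 with hn
  have hK : ∀ u, fejer m u ^ (q + 1) = trigSq c n u := by
    intro u
    rw [← norm_sq_sum_exp, ← hc, fejer, norm_pow]
    ring
  set L := ∫ u in (-δ)..δ, fejer m u ^ (q + 1) with hL
  set τ := (Real.pi / δ) ^ (2 * q) * (2 * Real.pi * m) with hτ
  have hL0 : 0 < L := lt_of_lt_of_le (by positivity) (le_integral_fejer_pow (q := q) hm0 hmδ)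
  have hτL : τ ≤ η / 8 * L := (tail_factor_le hδ hη hm20 hq3).trans
    (mul_le_mul_of_nonneg_left (le_integral_fejer_pow hm0 hmδ) (by positivity))
  have hcont : Continuous fun u => fejer m u ^ (q + 1) := (continuous_fejer m).pow _
  have hint : ∀ x y : ℝ, IntervalIntegrable (fun u => fejer m u ^ (q + 1)) volume x y :=
    fun x y => hcont.intervalIntegrable x y
  -- By Parseval `2π ∑ c a ^ 2` is the full mass of the kernel, at most `L + 2τ ≤ (1 + η/4) L`.
  have hκ : ∑ a ∈ Finset.range n, c a ^ 2 ≤ L := by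
    have h1 : ∫ u in (-Real.pi)..Real.pi, fejer m u ^ (q + 1) =
        2 * Real.pi * ∑ a ∈ Finset.range n, c a ^ 2 := by
      simp only [hK]
      exact integral_trigSq_period c n
    have h2 : ∫ u in (-Real.pi)..Real.pi, fejer m u ^ (q + 1) ≤ τ + L + τ := by
      rw [← intervalIntegral.integral_add_adjacent_intervals (hint _ (-δ)) (hint (-δ) _),
        ← intervalIntegral.integral_add_adjacent_intervals (hint (-δ) δ) (hint δ _), ← add_assoc]
      refine add_le_add (add_le_add ?_ le_rfl) ?_
      · refine integral_fejer_pow_le hδ (by linarith) le_rfl (by linarith) fun u hu => ?_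
        rw [abs_of_neg (by linarith [hu.2])]
        linarith [hu.2]
      · refine integral_fejer_pow_le hδ (by linarith) (by linarith) le_rfl fun u hu => ?_
        exact hu.1.trans (le_abs_self u)
    have h3 : 0 ≤ ∑ a ∈ Finset.range n, c a ^ 2 := Finset.sum_nonneg fun _ _ => sq_nonneg _
    have h4 : η * L ≤ 1 * L := mul_le_mul_of_nonneg_right hη' hL0.le
    nlinarith
  -- The filter at `y` is the mass of the kernel in `[y - π/2, y]` divided by `L`. Modes are indexed
  -- by pairs, so frequencies repeat; only the sum of absolute values matters, and they need not be
  -- merged.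
  have hG : ∀ y : ℝ, ∑ a : Fin n × Fin n,
      ((((L⁻¹ : ℝ) : ℂ) * (((c a.1 * c a.2 : ℝ) : ℂ) *
        quarterCoeff (((a.1 : ℕ) : ℤ) - ((a.2 : ℕ) : ℤ)))) *
        Complex.exp ((((((a.1 : ℕ) : ℤ) - ((a.2 : ℕ) : ℤ) : ℤ) * y : ℝ) : ℂ) * Complex.I)).re =
      L⁻¹ * ∫ u in (y - Real.pi / 2)..y, fejer m u ^ (q + 1) := by
    intro y
    simp only [hK]
    rw [integral_trigSq, Fintype.sum_prod_type, Finset.sum_range, Finset.mul_sum]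
    refine Finset.sum_congr rfl fun a _ => ?_
    rw [Finset.sum_range, Finset.mul_sum]
    refine Finset.sum_congr rfl fun b _ => ?_
    rw [integral_cos_quarter, mul_assoc, mul_assoc, Complex.re_ofReal_mul, Complex.re_ofReal_mul]
  refine ⟨(q + 1) * m, Fin n × Fin n, inferInstance, fun a => ((L⁻¹ : ℝ) : ℂ) *
    (((c a.1 * c a.2 : ℝ) : ℂ) * quarterCoeff (((a.1 : ℕ) : ℤ) - ((a.2 : ℕ) : ℤ))),
    fun a => ((a.1 : ℕ) : ℤ) - ((a.2 : ℕ) : ℤ), ?_, ?_, ?_, ?_, ?_, ?_, ?_⟩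
  · push_cast
    nlinarith
  · push_cast
    calc ((q : ℝ) + 1) * m ≤ (6 * plog (1 / η)) * (21 / δ) :=
          mul_le_mul hq6 hm21 (by positivity) (by linarith)
      _ = _ := by ring
  · intro a
    have h1 := a.1.2
    have h2 := a.2.2
    dsimp only
    rw [abs_le]
    constructor <;> omega
  · have h1 : ∑ a : Fin n × Fin n, ‖((L⁻¹ : ℝ) : ℂ) * (((c a.1 * c a.2 : ℝ) : ℂ) *
        quarterCoeff (((a.1 : ℕ) : ℤ) - ((a.2 : ℕ) : ℤ)))‖ ≤
          L⁻¹ * (8 * (1 + Real.log n) * ∑ a ∈ Finset.range n, c a ^ 2) := by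
      refine le_trans (le_of_eq ?_) (mul_le_mul_of_nonneg_left
        (sum_mul_norm_quarterCoeff_le c n) (by positivity))
      rw [Fintype.sum_prod_type, Finset.sum_range, Finset.mul_sum]
      refine Finset.sum_congr rfl fun a _ => ?_
      rw [Finset.sum_range, Finset.mul_sum]
      refine Finset.sum_congr rfl fun b _ => ?_
      rw [norm_mul, Complex.norm_real, Real.norm_of_nonneg (by positivity)]
    refine h1.trans ?_
    have hd1 : (1 : ℝ) ≤ ((q + 1) * m : ℕ) := by
      push_cast
      nlinarith
    have hlog : Real.log n ≤ 1 + Real.log ((q + 1) * m : ℕ) := by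
      have h2 : (n : ℝ) ≤ 2 * ((q + 1) * m : ℕ) := by
        rw [hn]
        push_cast at hd1 ⊢
        linarith
      refine (Real.log_le_log (by rw [hn]; positivity) h2).trans ?_
      rw [Real.log_mul two_ne_zero (by linarith)]
      linarith [Real.log_two_lt_d9]
    have hlog0 : 0 ≤ Real.log ((q + 1) * m : ℕ) := Real.log_nonneg hd1
    have hlogn : 0 ≤ Real.log n := Real.log_natCast_nonneg n
    calc L⁻¹ * (8 * (1 + Real.log n) * ∑ a ∈ Finset.range n, c a ^ 2)
        ≤ L⁻¹ * (8 * (1 + Real.log n) * L) := by gcongr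
      _ = 8 * (1 + Real.log n) := by field_simp
      _ ≤ _ := by linarith
  · intro y
    rw [hG]
    refine mul_nonneg (by positivity) (intervalIntegral.integral_nonneg (by linarith) fun u _ => ?_)
    exact pow_nonneg (fejer_nonneg m u) _
  -- From `y ≤ 1`, `δ ≤ 1/2` and `π > 3` the window contains `[-δ, δ]`, whose mass is `L`.
  · intro y hy1 hy2
    rw [hG, ← inv_mul_cancel₀ hL0.ne']
    refine mul_le_mul_of_nonneg_left ?_ (by positivity)
    refine intervalIntegral.integral_mono_interval (by linarith) (by linarith) hy1
      (Filter.Eventually.of_forall fun u => ?_) (hint _ _)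
    exact pow_nonneg (fejer_nonneg m u) _
  -- Here the window lies inside `[-π, -δ]` and sees only one tail.
  · intro y hy1 hy2
    rw [hG, inv_mul_le_iff₀ hL0]
    have : ∫ u in (y - Real.pi / 2)..y, fejer m u ^ (q + 1) ≤ τ := by
      refine integral_fejer_pow_le hδ (by linarith) (by linarith) (by linarith) fun u hu => ?_
      rw [abs_of_neg (by linarith [hu.2])]
      linarith [hu.2]
    nlinarith

/-! ### Poissonized evolution -/

/-- The Poisson weights. -/
def poissonWeight (ν : ℝ) (N : ℕ) : ℝ := Real.exp (-ν) * (ν ^ N / N.factorial)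

theorem poissonWeight_nonneg {ν : ℝ} (hν : 0 ≤ ν) (N : ℕ) : 0 ≤ poissonWeight ν N := by
  unfold poissonWeight
  positivity

/-- Chernoff bound: a term of index `m ≥ R` grows when multiplied by `exp(m - R)`, which turns the
tail into part of the series of `exp(e r)`. -/
theorem exp_sub_sum_le {r : ℝ} (hr : 0 ≤ r) (R : ℕ) :
    Real.exp r - ∑ m ∈ Finset.range R, r ^ m / m.factorial ≤
      Real.exp (-R) * Real.exp (Real.exp 1 * r) := by
  have hs : Filter.Tendsto (fun M => ∑ m ∈ Finset.range M, r ^ m / m.factorial) Filter.atTop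
      (nhds (Real.exp r)) := by
    have h := NormedSpace.expSeries_div_hasSum_exp r
    rw [← Real.exp_eq_exp_ℝ] at h
    exact h.tendsto_sum_nat
  refine le_of_tendsto (hs.sub_const _) ?_
  filter_upwards [Filter.eventually_ge_atTop R] with M hM
  rw [← Finset.sum_range_add_sum_Ico _ hM, add_sub_cancel_left]
  calc ∑ m ∈ Finset.Ico R M, r ^ m / m.factorial
      ≤ ∑ m ∈ Finset.Ico R M, Real.exp (-R) * ((Real.exp 1 * r) ^ m / m.factorial) := by
        refine Finset.sum_le_sum fun m hm => ?_
        have hm' : (R : ℝ) ≤ m := by exact_mod_cast (Finset.mem_Ico.1 hm).1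
        rw [mul_pow, mul_div_assoc, ← mul_assoc, ← Real.exp_nat_mul, ← Real.exp_add]
        exact le_mul_of_one_le_left (by positivity) (Real.one_le_exp (by linarith))
    _ = Real.exp (-R) * ∑ m ∈ Finset.Ico R M, (Real.exp 1 * r) ^ m / m.factorial := by
        rw [Finset.mul_sum]
    _ ≤ Real.exp (-R) * ∑ m ∈ Finset.range M, (Real.exp 1 * r) ^ m / m.factorial := by
        refine mul_le_mul_of_nonneg_left ?_ (Real.exp_pos _).le
        rw [← Finset.sum_range_add_sum_Ico _ hM]
        exact le_add_of_nonneg_left (Finset.sum_nonneg fun _ _ => by positivity)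
    _ ≤ _ := mul_le_mul_of_nonneg_left (Real.sum_le_exp_of_nonneg (by positivity) M)
        (Real.exp_pos _).le

/-- The Poisson generating function is `exp(ν(z - 1))`. With `e ≤ 3` and `‖z‖ ≤ 2` the tail bound
has exponent `-ν - R + 6ν`. -/
theorem norm_sum_poissonWeight_sub_exp_le {ν : ℝ} (hν : 0 ≤ ν) {z : ℂ} (hz : ‖z‖ ≤ 2) (R : ℕ) :
    ‖∑ N ∈ Finset.range R, (poissonWeight ν N : ℂ) * z ^ N - Complex.exp (ν * (z - 1))‖ ≤
      Real.exp (5 * ν - R) := by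
  have h1 : ∑ N ∈ Finset.range R, (poissonWeight ν N : ℂ) * z ^ N =
      Complex.exp (-ν) * ∑ N ∈ Finset.range R, (ν * z) ^ N / N.factorial := by
    rw [Finset.mul_sum]
    refine Finset.sum_congr rfl fun N _ => ?_
    rw [poissonWeight]
    push_cast
    rw [mul_pow]
    ring
  have h2 : Complex.exp (ν * (z - 1)) = Complex.exp (-ν) * Complex.exp (ν * z) := by
    rw [← Complex.exp_add]
    ring_nf
  have hx : ‖(ν : ℂ) * z‖ ≤ 2 * ν := by
    rw [norm_mul, Complex.norm_real, Real.norm_of_nonneg hν]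
    nlinarith
  rw [h1, h2, ← mul_sub, norm_mul, norm_sub_rev, ← Complex.ofReal_neg, Complex.norm_exp_ofReal]
  have h3 := (Complex.norm_exp_sub_sum_le_exp_norm_sub_sum (ν * z) R).trans
    (exp_sub_sum_le (norm_nonneg _) R)
  calc Real.exp (-ν) * ‖Complex.exp (ν * z) - ∑ N ∈ Finset.range R, (ν * z) ^ N / N.factorial‖
      ≤ Real.exp (-ν) * (Real.exp (-R) * Real.exp (Real.exp 1 * ‖(ν : ℂ) * z‖)) :=
        mul_le_mul_of_nonneg_left h3 (Real.exp_pos _).le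
    _ ≤ Real.exp (5 * ν - R) := by
        rw [← Real.exp_add, ← Real.exp_add, Real.exp_le_exp]
        have h4 : Real.exp 1 * ‖(ν : ℂ) * z‖ ≤ 3 * (2 * ν) :=
          mul_le_mul (by linarith [Real.exp_one_lt_d9]) hx (norm_nonneg _) (by norm_num)
        linarith

theorem sum_poissonWeight_mul_pow_le {ν r : ℝ} (hν : 0 ≤ ν) (hr : 0 ≤ r) (R : ℕ) :
    ∑ N ∈ Finset.range R, poissonWeight ν N * r ^ N ≤ Real.exp (ν * (r - 1)) := by
  have h1 : ∑ N ∈ Finset.range R, poissonWeight ν N * r ^ N =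
      Real.exp (-ν) * ∑ N ∈ Finset.range R, (ν * r) ^ N / N.factorial := by
    rw [Finset.mul_sum]
    refine Finset.sum_congr rfl fun N _ => ?_
    rw [poissonWeight, mul_pow]
    ring
  rw [h1, show ν * (r - 1) = -ν + ν * r by ring, Real.exp_add]
  exact mul_le_mul_of_nonneg_left (Real.sum_le_exp_of_nonneg (by positivity) R) (Real.exp_pos _).le

/-! ### Bisection -/

/-- Bisection on the integers `a, …, a + 2 ^ k`: moves to the upper half where `f` holds at the
midpoint, and returns the left end of the final interval. -/
def bisect (f : ℕ → Bool) : ℕ → ℕ → ℕ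
  | 0, a => a
  | k + 1, a => if f (a + 2 ^ k) then bisect f k (a + 2 ^ k) else bisect f k a

/-- The points at which a bisection evaluates the function. -/
def bisectPoints (f : ℕ → Bool) : ℕ → ℕ → Finset ℕ
  | 0, _ => ∅
  | k + 1, a =>
      insert (a + 2 ^ k) (if f (a + 2 ^ k) then bisectPoints f k (a + 2 ^ k)
        else bisectPoints f k a)

theorem card_bisectPoints_le (f : ℕ → Bool) (k a : ℕ) : (bisectPoints f k a).card ≤ k := by
  induction k generalizing a with
  | zero => simp [bisectPoints]
  | succ k ih =>
    rw [bisectPoints]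
    refine (Finset.card_insert_le _ _).trans (Nat.succ_le_succ ?_)
    split_ifs <;> exact ih _

theorem lt_of_mem_bisectPoints (f : ℕ → Bool) (k a x : ℕ) (hx : x ∈ bisectPoints f k a) :
    x < a + 2 ^ k := by
  induction k generalizing a with
  | zero => simp [bisectPoints] at hx
  | succ k ih =>
    have h2 : 0 < 2 ^ k := by positivity
    rw [bisectPoints, Finset.mem_insert] at hx
    rw [pow_succ]
    rcases hx with rfl | hx
    · omega
    · split_ifs at hx
      · have := ih _ hx; omega
      · have := ih _ hx; omega

/-- A bisection sees its function only along its own path. This lets a random comparison function be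
exchanged for a deterministic one. -/
theorem bisect_congr {f g : ℕ → Bool} (k a : ℕ) (h : ∀ x ∈ bisectPoints g k a, f x = g x) :
    bisect f k a = bisect g k a := by
  induction k generalizing a with
  | zero => rfl
  | succ k ih =>
    rw [bisectPoints] at h
    have h0 := h (a + 2 ^ k) (Finset.mem_insert_self _ _)
    rw [bisect, bisect, h0]
    split_ifs with hg
    · exact ih _ fun x hx => h x (Finset.mem_insert_of_mem (by rwa [if_pos hg]))
    · exact ih _ fun x hx => h x (Finset.mem_insert_of_mem (by rwa [if_neg hg]))

/-- The left end moves only to midpoints where `f` holds. Dually, in `bisect_right` the right end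
moves only to midpoints where `f` fails. -/
theorem bisect_left (f : ℕ → Bool) (k a : ℕ) : bisect f k a = a ∨ f (bisect f k a) = true := by
  induction k generalizing a with
  | zero => simp [bisect]
  | succ k ih =>
    rw [bisect]
    split_ifs with hf
    · rcases ih (a + 2 ^ k) with h | h
      · rw [h]; exact Or.inr hf
      · exact Or.inr h
    · exact ih a

theorem bisect_right (f : ℕ → Bool) (k a : ℕ) :
    bisect f k a + 1 = a + 2 ^ k ∨ f (bisect f k a + 1) = false := by
  induction k generalizing a with
  | zero => simp [bisect]
  | succ k ih =>
    rw [bisect]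
    split_ifs with hf
    · rcases ih (a + 2 ^ k) with h | h
      · left; rw [h, pow_succ]; omega
      · exact Or.inr h
    · rcases ih a with h | h
      · right; rw [h]; simpa using hf
      · exact Or.inr h

/-- Bisection on a grid of spacing `Δ` locates `E` up to `Δ`, if the comparisons with `E` are right
at those points of a fixed small set that are not within `Δ / 4` of `E`. -/
theorem exists_bisect_points (k : ℕ) (x₀ Δ E : ℝ) (hΔ : 0 < Δ) (h0 : x₀ ≤ E)
    (h1 : E ≤ x₀ + 2 ^ k * Δ) :
    ∃ s : Finset ℕ, s.card ≤ 2 * k ∧ (∀ x ∈ s, x < 2 ^ k) ∧ ∀ f : ℕ → Bool,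
      (∀ x ∈ s, (x₀ + x * Δ ≤ E - Δ / 4 → f x = true) ∧
        (E + Δ / 4 ≤ x₀ + x * Δ → f x = false)) →
      |x₀ + bisect f k 0 * Δ + Δ / 2 - E| ≤ Δ := by
  classical
  -- Idealized comparisons, with the arbitrary answer `b` within `Δ/4` of `E`. The spacing `Δ`
  -- exceeds the width `Δ/2` of this ambiguous zone, so at most one grid point lies in it. Any
  -- admissible `f` thus follows the path of `g true` or of `g false`, and these two paths make up
  -- the point set.
  set g : Bool → ℕ → Bool := fun b x =>
    if x₀ + x * Δ ≤ E - Δ / 4 then true else if E + Δ / 4 ≤ x₀ + x * Δ then false else b with hg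
  refine ⟨bisectPoints (g true) k 0 ∪ bisectPoints (g false) k 0, ?_, ?_, fun f hf => ?_⟩
  · refine (Finset.card_union_le _ _).trans ?_
    have := card_bisectPoints_le (g true) k 0
    have := card_bisectPoints_le (g false) k 0
    omega
  · intro x hx
    rcases Finset.mem_union.1 hx with h | h
    · simpa using lt_of_mem_bisectPoints _ _ _ _ h
    · simpa using lt_of_mem_bisectPoints _ _ _ _ h
  · have key : ∃ b, ∀ x ∈ bisectPoints (g b) k 0, f x = g b x := by
      have hsub : ∀ b, ∀ x ∈ bisectPoints (g b) k 0,
          x ∈ bisectPoints (g true) k 0 ∪ bisectPoints (g false) k 0 := by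
        intro b x hx
        cases b
        · exact Finset.mem_union_right _ hx
        · exact Finset.mem_union_left _ hx
      by_cases hp : ∃ p : ℕ, E - Δ / 4 < x₀ + p * Δ ∧ x₀ + p * Δ < E + Δ / 4
      · obtain ⟨p, hp1, hp2⟩ := hp
        refine ⟨f p, fun x hx => ?_⟩
        have hx' := hf x (hsub _ x hx)
        simp only [hg]
        split_ifs with h2 h3
        · exact hx'.1 h2
        · exact hx'.2 h3
        · push Not at h2 h3
          have hxp : x = p := by
            by_contra hne
            rcases lt_or_gt_of_ne hne with hlt | hlt
            · have : (x : ℝ) + 1 ≤ p := by exact_mod_cast hlt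
              nlinarith
            · have : (p : ℝ) + 1 ≤ x := by exact_mod_cast hlt
              nlinarith
          rw [hxp]
      · push Not at hp
        refine ⟨true, fun x hx => ?_⟩
        have hx' := hf x (hsub _ x hx)
        simp only [hg]
        split_ifs with h2 h3
        · exact hx'.1 h2
        · exact hx'.2 h3
        · exact absurd (hp x (not_le.1 h2)) h3
    obtain ⟨b, hb⟩ := key
    rw [bisect_congr k 0 hb]
    have hl := bisect_left (g b) k 0
    have hr := bisect_right (g b) k 0
    set r := bisect (g b) k 0
    have hlow : x₀ + r * Δ ≤ E + Δ / 4 := by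
      rcases hl with h | h
      · rw [h]
        push_cast
        linarith
      · by_contra hcon
        have : g b r = false := by
          simp only [hg]
          rw [if_neg (by linarith), if_pos (by linarith)]
        rw [this] at h
        exact absurd h (by simp)
    have hhigh : E - Δ / 4 ≤ x₀ + (r + 1 : ℕ) * Δ := by
      rcases hr with h | h
      · rw [h]
        push_cast
        linarith
      · by_contra hcon
        have : g b (r + 1) = true := by
          simp only [hg]
          rw [if_pos (by linarith)]
        rw [this] at h
        exact absurd h (by simp)
    push_cast at hhigh
    -- The midpoint of the final interval is off by at most `Δ/2 + Δ/4`.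
    rw [abs_le]
    constructor <;> linarith

/-! ### Sampling Hadamard tests -/

/-- The template of the Hadamard test for `N` sampled rotations by the angle `θ`. -/
def testTemplate (n : ℕ) (θ : ℝ) (N : ℕ) (q : Bool) : List (Instruction n) :=
  .gate (.hadamard 0) :: ((if q then [.gate (.phase 0)] else []) ++
    (List.replicate N (.sampled (controlledRot θ)) ++ [.gate (.hadamard 0)]))

theorem flatMap_controlledRot_mat {n : ℕ} (θ : ℝ) (ls : List (Bool × PauliString n)) :
    Circuit.mat (ls.flatMap (controlledRot θ)) =
      blockDiag 1 ((ls.map fun P => rot P.2.mat (if P.1 then -θ else θ)).reverse.prod) := by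
  induction ls with
  | nil =>
    ext x y
    induction x using Fin.consCases with
    | _ a x =>
      induction y using Fin.consCases with
      | _ b y =>
        fin_cases a <;> fin_cases b <;>
          simp [Circuit.mat, blockDiag, Matrix.one_apply, Fin.cons_inj]
  | cons P ls ih =>
    rw [List.flatMap_cons, Circuit.mat_append, ih, controlledRot_mat, blockDiag_mul]
    simp

/-- The Hadamard test value is real-linear in the implemented unitary, and the sampled factors are
independent. The mean therefore involves the exact power of the mean step, without compilation bias.
-/
theorem compileExp_testTemplate {n : ℕ} (H : Hamiltonian n) (ρ : QState n) (θ : ℝ) (N : ℕ)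
    (q : Bool) :
    compileExp H (testTemplate n θ N q)
        (fun c => outcomeProb c ρ false - outcomeProb c ρ true) =
      ((if q then Complex.I else 1) *
        (ρ.mat * rot ((H.weight⁻¹ : ℝ) • H.mat) θ ^ N).trace).re := by
  have hΛ : ∃ Λ : QMat (Fin n) →ₗ[ℝ] ℝ, ∀ U, Λ U =
      ((if q then Complex.I else 1) * (ρ.mat * U).trace).re :=
    ⟨{ toFun := fun U => ((if q then Complex.I else 1) * (ρ.mat * U).trace).re
       map_add' := fun U V => by
        rw [Matrix.mul_add, Matrix.trace_add, mul_add, Complex.add_re]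
       map_smul' := fun r U => by
        rw [Matrix.mul_smul, Matrix.trace_smul, mul_smul_comm, Complex.smul_re]
        rfl }, fun _ => rfl⟩
  obtain ⟨Λ, hΛ⟩ := hΛ
  have hmain := compileExp_replicate H (controlledRot θ) (.hadamard 0)
    (fun P => rot P.2.mat (if P.1 then -θ else θ)) N
    (fun c => outcomeProb (.hadamard 0 :: ((if q then [.phase 0] else []) ++ c)) ρ false -
      outcomeProb (.hadamard 0 :: ((if q then [.phase 0] else []) ++ c)) ρ true) Λ
    (fun ls _ => by
      rw [hΛ, ← hadamardTest_outcomeProb_sub q _ _ (flatMap_controlledRot_mat θ ls) ρ,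
        hadamardTest])
  rw [sum_rot_signedTerm, hΛ] at hmain
  rw [← hmain, testTemplate, compileExp]
  cases q
  · simp only [Bool.false_eq_true, if_false, List.nil_append]
  · simp only [if_true, List.singleton_append, compileExp]

theorem rotationCount_le_of_mem_support_testTemplate {n : ℕ} (H : Hamiltonian n) (θ : ℝ) (N : ℕ)
    (q : Bool) (c : Circuit (Fin (n + 1)))
    (hc : c ∈ (compile H (testTemplate n θ N q)).support) :
    Circuit.rotationCount c ≤ 2 * N := by
  have key : ∀ d ∈ (compile H (List.replicate N (.sampled (controlledRot θ)) ++
      [.gate (.hadamard 0)])).support, Circuit.rotationCount d ≤ 2 * N :=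
    Circuit.rotationCount_le_of_mem_support_compile H _ (controlledRot_rotationCount θ)
      (.hadamard 0) rfl N
  cases q
  · simp only [testTemplate, Bool.false_eq_true, if_false, List.nil_append, compile,
      PMF.mem_support_map_iff] at hc
    obtain ⟨d, hd, rfl⟩ := hc
    exact key d hd
  · simp only [testTemplate, if_true, List.singleton_append, compile,
      PMF.mem_support_map_iff] at hc
    obtain ⟨d, ⟨e, he, rfl⟩, rfl⟩ := hc
    exact key e he

theorem outcomeLaw_apply {n : ℕ} (c : Circuit (Fin (n + 1))) (ρ : QState n) (b : Bool) :
    outcomeLaw c ρ b = ENNReal.ofReal (outcomeProb c ρ b) := rfl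

theorem bind_outcomeLaw_apply {n : ℕ} {S : Type} (p : PMF S) (T : S → List (Instruction n)) (H : Hamiltonian n)
    (ρ : QState n) (s : S) (b : Bool) :
    (p.bind fun s => (compile H (T s)).bind fun c => (outcomeLaw c ρ).map fun b => (s, b)) (s, b) =
      p s * ENNReal.ofReal (compileExp H (T s) fun c => outcomeProb c ρ b) := by
  classical
  have h1 : ∀ (c : Circuit (Fin (n + 1))) (s' : S),
      ((outcomeLaw c ρ).map fun b => (s', b)) (s, b) =
        if s = s' then ENNReal.ofReal (outcomeProb c ρ b) else 0 := by
    intro c s'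
    rw [PMF.map_apply, tsum_fintype, Fintype.sum_bool]
    cases b <;> by_cases hs : s = s' <;> simp [hs, outcomeLaw_apply]
  rw [PMF.bind_apply, tsum_eq_single s]
  · congr 1
    rw [PMF.bind_apply, ← tsum_compile_mul H (T s) _ fun c => outcomeProb_nonneg c ρ b]
    simp [h1]
  · intro s' hs'
    rw [PMF.bind_apply]
    simp [h1, hs'.symm]

section

variable {n : ℕ} {S : Type} [Fintype S] [Nonempty S]

/-- A numbering of the seeds. -/
def seedIndex (s : S) : ℕ := Fintype.equivFin S s

/-- The seed with a given number. -/
def seedOf (t : ℕ) : S := Function.invFun seedIndex t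

theorem seedOf_seedIndex (s : S) : seedOf (seedIndex s) = s :=
  Function.leftInverse_invFun
    (fun _ _ h => (Fintype.equivFin S).injective (Fin.val_injective h)) s

/-- The algorithm that repeats `N` times: draw a seed from the finite type `S` according to `p` and
run the template `T`. -/
def repeatedAlgorithm (N : ℕ) (p : PMF S) (T : S → List (Instruction n))
    (est : (Fin N → S × Bool) → ℝ) : Algorithm n where
  numCircuits := N
  seedLaw _ := p.map seedIndex
  template _ t := T (seedOf t)
  estimate ω := est fun i => (seedOf (ω i).1, (ω i).2)

theorem mem_support_circuitLaw_repeatedAlgorithm {N : ℕ} {p : PMF S}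
    {T : S → List (Instruction n)} {est : (Fin N → S × Bool) → ℝ} {H : Hamiltonian n}
    {i : Fin N} {c : Circuit (Fin (n + 1))}
    (hc : c ∈ ((repeatedAlgorithm N p T est).circuitLaw H i).support) :
    ∃ s, c ∈ (compile H (T s)).support := by
  simp only [Algorithm.circuitLaw, PMF.mem_support_bind_iff] at hc
  obtain ⟨t, _, ht⟩ := hc
  exact ⟨seedOf t, ht⟩

/-- Outcome `0` counts as `+1` and outcome `1` as `-1`, so conditionally on the seed the mean is the
Hadamard test value. Seeds are stored as natural numbers and decoded by `seedOf`. -/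
theorem integral_roundLaw_repeatedAlgorithm (N : ℕ) (p : PMF S) (T : S → List (Instruction n))
    (est : (Fin N → S × Bool) → ℝ) (H : Hamiltonian n) (ρ : QState n) (i : Fin N) (z : S → ℝ) :
    ∫ a, (if a.2 then -1 else 1) * z (seedOf a.1)
        ∂((repeatedAlgorithm N p T est).roundLaw H ρ i).toMeasure =
      ∑ s, (p s).toReal * (z s *
        compileExp H (T s) fun c => outcomeProb c ρ false - outcomeProb c ρ true) := by
  let _ : MeasurableSpace S := ⊤
  have _ : DiscreteMeasurableSpace S := ⟨fun _ => trivial⟩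
  set κ : PMF (S × Bool) :=
    p.bind fun s => (compile H (T s)).bind fun c => (outcomeLaw c ρ).map fun b => (s, b) with hκ
  have hround : (repeatedAlgorithm N p T est).roundLaw H ρ i =
      κ.map fun a => (seedIndex a.1, a.2) := by
    rw [hκ, PMF.map_bind]
    change ((p.map seedIndex).bind fun t => (compile H (T (seedOf t))).bind fun c =>
      (outcomeLaw c ρ).map fun b => (t, b)) = _
    rw [PMF.bind_map]
    congr 1
    funext s
    simp only [Function.comp_apply, seedOf_seedIndex, PMF.map_bind, PMF.map_comp]
    rfl
  rw [hround, ← PMF.toMeasure_map _ _ (by fun_prop), integral_map (by fun_prop) (by fun_prop),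
    PMF.integral_eq_sum, Fintype.sum_prod_type]
  refine Finset.sum_congr rfl fun s _ => ?_
  rw [Fintype.sum_bool, compileExp_sub, hκ, bind_outcomeLaw_apply, bind_outcomeLaw_apply,
    ENNReal.toReal_mul, ENNReal.toReal_mul,
    ENNReal.toReal_ofReal (compileExp_nonneg _ _ _ fun c => outcomeProb_nonneg c ρ _),
    ENNReal.toReal_ofReal (compileExp_nonneg _ _ _ fun c => outcomeProb_nonneg c ρ _)]
  simp only [seedOf_seedIndex, smul_eq_mul, if_true, Bool.false_eq_true, if_false]
  ring

end

/-! ### Concentration -/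

/-- Hoeffding's inequality for the empirical mean of independent bounded variables. -/
theorem measureReal_abs_mean_sub_ge_le {α : Type} [MeasurableSpace α] {N : ℕ} (hN : 0 < N)
    (μ : Fin N → Measure α) [∀ i, IsProbabilityMeasure (μ i)] {Z : α → ℝ} (hZ : Measurable Z)
    {B m ε : ℝ} (hB : 0 < B) (hε : 0 ≤ ε) (hbd : ∀ a, |Z a| ≤ B)
    (hm : ∀ i, ∫ a, Z a ∂(μ i) = m) :
    (Measure.pi μ).real {ω | ε ≤ |(∑ i, Z (ω i)) / N - m|} ≤
      2 * Real.exp (-(N * ε ^ 2 / (2 * B ^ 2))) := by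
  have hN' : (0 : ℝ) < N := by exact_mod_cast hN
  have hone : ∀ (Y : α → ℝ), Measurable Y → (∀ a, |Y a| ≤ B) → ∀ m', (∀ i, ∫ a, Y a ∂(μ i) = m') →
      (Measure.pi μ).real {ω | N * ε ≤ ∑ i, (Y (ω i) - m')} ≤
        Real.exp (-(N * ε ^ 2 / (2 * B ^ 2))) := by
    intro Y hY hYB m' hm'
    have hind : ProbabilityTheory.iIndepFun (fun (i : Fin N) (ω : Fin N → α) => Y (ω i) - m')
        (Measure.pi μ) :=
      ProbabilityTheory.iIndepFun_pi (X := fun _ a => Y a - m')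
        fun i => (hY.sub_const m').aemeasurable
    have hsub : ∀ i ∈ Finset.univ, ProbabilityTheory.HasSubgaussianMGF
        (fun ω : Fin N → α => Y (ω i) - m') ((‖B - (-B)‖₊ / 2) ^ 2) (Measure.pi μ) := by
      intro i _
      have hint : ∫ ω : Fin N → α, Y (ω i) ∂(Measure.pi μ) = m' := by
        rw [integral_comp_eval (μ := μ) (i := i) hY.aestronglyMeasurable, hm']
      have h := ProbabilityTheory.hasSubgaussianMGF_of_mem_Icc (μ := Measure.pi μ)
        (X := fun ω : Fin N → α => Y (ω i)) (a := -B) (b := B)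
        (hY.comp (measurable_pi_apply i)).aemeasurable
        (Filter.Eventually.of_forall fun ω => abs_le.1 (hYB (ω i)))
      rwa [hint] at h
    have h := ProbabilityTheory.HasSubgaussianMGF.measure_sum_ge_le_of_iIndepFun hind hsub
      (ε := N * ε) (by positivity)
    refine h.trans (le_of_eq ?_)
    congr 1
    -- Half the length of the range `[-B, B]`: the sub-Gaussian parameter is `B²`.
    have hBB : ‖B - (-B)‖ / 2 = B := by
      rw [sub_neg_eq_add, Real.norm_of_nonneg (by linarith)]
      ring
    rw [Finset.sum_const, Finset.card_univ, Fintype.card_fin]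
    push_cast
    rw [hBB, nsmul_eq_mul]
    field_simp
  have hsum : ∀ (Y : α → ℝ) (m' : ℝ) (ω : Fin N → α),
      ∑ i, (Y (ω i) - m') = ∑ i, Y (ω i) - N * m' := by
    intro Y m' ω
    rw [Finset.sum_sub_distrib, Finset.sum_const, Finset.card_univ, Fintype.card_fin, nsmul_eq_mul]
  have hsubset : {ω : Fin N → α | ε ≤ |(∑ i, Z (ω i)) / N - m|} ⊆
      {ω | N * ε ≤ ∑ i, (Z (ω i) - m)} ∪ {ω | N * ε ≤ ∑ i, (-Z (ω i) - -m)} := by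
    intro ω hω
    have hdiv : N * ((∑ i, Z (ω i)) / N - m) = ∑ i, Z (ω i) - N * m := by field_simp
    have hω' : ε ≤ |(∑ i, Z (ω i)) / N - m| := hω
    rcases le_abs.1 hω' with h | h
    · left
      rw [Set.mem_ofPred_eq, hsum, ← hdiv]
      exact mul_le_mul_of_nonneg_left h hN'.le
    · right
      rw [Set.mem_ofPred_eq, hsum (fun a => -Z a), Finset.sum_neg_distrib]
      have := mul_le_mul_of_nonneg_left h hN'.le
      linarith
  refine (measureReal_mono hsubset).trans ((measureReal_union_le _ _).trans ?_)
  have h1 := hone Z hZ hbd m hm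
  have h2 := hone (fun a => -Z a) hZ.neg (fun a => by rw [abs_neg]; exact hbd a) (-m)
    (fun i => by rw [integral_neg, hm])
  linarith

/-! ### Amplitudes of the Poissonized evolution -/

/-- The angle of the sampled rotations for the evolution time `j / 4` in units of the inverse
weight, when the mean number of rotations is `ν`. -/
def stepAngle (ν : ℝ) (j : ℤ) : ℝ := Real.arctan (-(j / (4 * ν)))

/-- The weight of a step, which normalizes the mean sampled rotation. -/
def stepWeight (ν : ℝ) (j : ℤ) : ℝ := √(1 + (-(j / (4 * ν))) ^ 2)

/-- `stepWeight` is the reciprocal cosine of the angle, so the rescaled step is `1 + i tan θ e` with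
`tan θ = -j/(4ν)`. -/
theorem stepWeight_mul (ν : ℝ) (j : ℤ) (e : ℝ) :
    (stepWeight ν j : ℂ) * (((Real.cos (stepAngle ν j) : ℝ) : ℂ) +
      Complex.I * ((Real.sin (stepAngle ν j) : ℝ) : ℂ) * (e : ℂ)) =
        1 + ((-(j / (4 * ν)) * e : ℝ) : ℂ) * Complex.I := by
  have hpos : 0 < 1 + (-((j : ℝ) / (4 * ν))) ^ 2 := by positivity
  rw [stepAngle, Real.cos_arctan, Real.sin_arctan, stepWeight]
  set s := -((j : ℝ) / (4 * ν))
  have hne : ((√(1 + s ^ 2) : ℝ) : ℂ) ≠ 0 := by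
    rw [Complex.ofReal_ne_zero]
    exact (Real.sqrt_pos.2 hpos).ne'
  rw [Complex.ofReal_div, Complex.ofReal_div, Complex.ofReal_one, Complex.ofReal_mul]
  field_simp

theorem abs_div_four_mul_sq_le {d : ℕ} (hd : 1 ≤ d) {j : ℤ} (hj : |j| ≤ d) :
    |(j : ℝ) / (4 * (d : ℝ) ^ 2)| ≤ 1 / (4 * (d : ℝ)) := by
  have hd' : (1 : ℝ) ≤ d := by exact_mod_cast hd
  have hj' : |(j : ℝ)| ≤ d := by exact_mod_cast hj
  rw [abs_div, abs_of_pos (show (0 : ℝ) < 4 * (d : ℝ) ^ 2 by positivity),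
    div_le_div_iff₀ (by positivity) (by positivity)]
  nlinarith

/-- The Poisson average of the powers of `1 - i j e/(4ν)` with `ν = d²` is the exponential, up to
truncation at `13ν`; the error exponent is `5ν - 13ν`. -/
theorem norm_sum_step_sub_exp_le {d : ℕ} (hd : 1 ≤ d) {j : ℤ} (hj : |j| ≤ d) {e : ℝ}
    (he : |e| ≤ 1) :
    ‖∑ N ∈ Finset.range (13 * d ^ 2), ((poissonWeight ((d : ℝ) ^ 2) N *
        stepWeight ((d : ℝ) ^ 2) j ^ N : ℝ) : ℂ) *
      (((Real.cos (stepAngle ((d : ℝ) ^ 2) j) : ℝ) : ℂ) +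
        Complex.I * ((Real.sin (stepAngle ((d : ℝ) ^ 2) j) : ℝ) : ℂ) * (e : ℂ)) ^ N -
      Complex.exp (((-(j * (e / 4)) : ℝ) : ℂ) * Complex.I)‖ ≤ Real.exp (-(8 * (d : ℝ) ^ 2)) := by
  have hd' : (1 : ℝ) ≤ d := by exact_mod_cast hd
  have hz : ‖(1 : ℂ) + ((-(j / (4 * (d : ℝ) ^ 2)) * e : ℝ) : ℂ) * Complex.I‖ ≤ 2 := by
    refine (norm_add_le _ _).trans ?_
    rw [norm_one, norm_mul, Complex.norm_I, mul_one, Complex.norm_real, Real.norm_eq_abs, abs_mul,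
      abs_neg]
    have h1 := abs_div_four_mul_sq_le hd hj
    have h2 : 1 / (4 * (d : ℝ)) ≤ 1 := by
      rw [div_le_one (by positivity)]
      linarith
    have h3 := mul_le_mul (h1.trans h2) he (abs_nonneg e) zero_le_one
    linarith
  have h := norm_sum_poissonWeight_sub_exp_le (ν := (d : ℝ) ^ 2) (by positivity) hz (13 * d ^ 2)
  have hexp : ((d : ℝ) ^ 2 : ℝ) * ((1 : ℂ) + ((-(j / (4 * (d : ℝ) ^ 2)) * e : ℝ) : ℂ) * Complex.I
      - 1) = ((-(j * (e / 4)) : ℝ) : ℂ) * Complex.I := by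
    have hne : (d : ℂ) ≠ 0 := by
      have : (d : ℝ) ≠ 0 := by linarith
      exact_mod_cast this
    push_cast
    field_simp
    ring
  rw [hexp] at h
  refine le_trans (le_of_eq ?_) (h.trans_eq ?_)
  · congr 2
    refine Finset.sum_congr rfl fun N _ => ?_
    rw [← stepWeight_mul, mul_pow]
    push_cast
    ring
  · push_cast
    ring_nf

/-- The price of rescaling is at most `exp(ν(stepWeight - 1))`. Since the tangent is at most
`1/(4d)`, the choice `ν = d²` keeps the exponent below `1/32`; this is why the number of rotations
is quadratic in the degree. -/
theorem sum_step_weight_le {d : ℕ} (hd : 1 ≤ d) {j : ℤ} (hj : |j| ≤ d) :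
    ∑ N ∈ Finset.range (13 * d ^ 2), poissonWeight ((d : ℝ) ^ 2) N *
        stepWeight ((d : ℝ) ^ 2) j ^ N ≤ 2 := by
  have hd' : (1 : ℝ) ≤ d := by exact_mod_cast hd
  refine (sum_poissonWeight_mul_pow_le (r := stepWeight ((d : ℝ) ^ 2) j) (by positivity)
    (Real.sqrt_nonneg _) _).trans ?_
  have h1 := abs_div_four_mul_sq_le hd hj
  set s := (j : ℝ) / (4 * (d : ℝ) ^ 2) with hs
  have h2 : stepWeight ((d : ℝ) ^ 2) j ≤ 1 + s ^ 2 / 2 := by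
    rw [stepWeight, neg_sq]
    exact Real.sqrt_le_iff.2 ⟨by positivity, by nlinarith [sq_nonneg (s ^ 2)]⟩
  have h3 : s ^ 2 ≤ (1 / (4 * (d : ℝ))) ^ 2 := sq_le_sq' (abs_le.1 h1).1 (abs_le.1 h1).2
  have h4 : (d : ℝ) ^ 2 * (stepWeight ((d : ℝ) ^ 2) j - 1) ≤ 1 / 32 := by
    calc (d : ℝ) ^ 2 * (stepWeight ((d : ℝ) ^ 2) j - 1)
        ≤ (d : ℝ) ^ 2 * ((1 / (4 * (d : ℝ))) ^ 2 / 2) :=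
          mul_le_mul_of_nonneg_left (by linarith) (by positivity)
      _ = 1 / 32 := by field_simp; norm_num
  calc Real.exp ((d : ℝ) ^ 2 * (stepWeight ((d : ℝ) ^ 2) j - 1)) ≤ Real.exp (1 / 32) :=
        Real.exp_le_exp.2 h4
    _ ≤ Real.exp (Real.log 2) := Real.exp_le_exp.2 (by linarith [Real.log_two_gt_d9])
    _ = 2 := Real.exp_log two_pos

/-! ### The estimator -/

/-- The relative frequency of a seed, which consists of a Fourier mode, a number of rotations, and
a choice between the real and the imaginary part. -/
def seedWeight {ι : Type} (F : ι → ℂ) (j : ι → ℤ) (d : ℕ) (s : ι × Fin (13 * d ^ 2) × Bool) : ℝ :=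
  ‖F s.1‖ * (poissonWeight ((d : ℝ) ^ 2) s.2.1 * stepWeight ((d : ℝ) ^ 2) (j s.1) ^ (s.2.1 : ℕ))

theorem seedWeight_nonneg {ι : Type} (F : ι → ℂ) (j : ι → ℤ) (d : ℕ) (s : ι × Fin (13 * d ^ 2) × Bool) :
    0 ≤ seedWeight F j d s :=
  mul_nonneg (norm_nonneg _) (mul_nonneg (poissonWeight_nonneg (by positivity) _)
    (pow_nonneg (Real.sqrt_nonneg _) _))

/-- One factor `2` counts the real and imaginary parts, the other comes from `sum_step_weight_le`.
-/
theorem sum_seedWeight_le {ι : Type} [Fintype ι] (F : ι → ℂ) (j : ι → ℤ) {d : ℕ} (hd : 1 ≤ d) (hj : ∀ a, |j a| ≤ d) :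
    ∑ s, seedWeight F j d s ≤ 4 * ∑ a, ‖F a‖ := by
  rw [Fintype.sum_prod_type, Finset.mul_sum]
  refine Finset.sum_le_sum fun a _ => ?_
  rw [Fintype.sum_prod_type]
  simp only [seedWeight, Finset.sum_const, Finset.card_univ, Fintype.card_bool]
  rw [← Finset.smul_sum, ← Finset.mul_sum, ← Finset.sum_range fun N =>
    poissonWeight ((d : ℝ) ^ 2) N * stepWeight ((d : ℝ) ^ 2) (j a) ^ N]
  have := mul_le_mul_of_nonneg_left (sum_step_weight_le hd (hj a)) (norm_nonneg (F a))
  rw [nsmul_eq_mul]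
  push_cast
  linarith

theorem sum_seedWeight_pos {ι : Type} [Fintype ι] (F : ι → ℂ) (j : ι → ℤ) {d : ℕ} (hd : 1 ≤ d) (hF : ∃ a, F a ≠ 0) :
    0 < ∑ s, seedWeight F j d s := by
  obtain ⟨a, ha⟩ := hF
  have hR : 0 < 13 * d ^ 2 := by positivity
  refine Finset.sum_pos' (fun s _ => seedWeight_nonneg F j d s)
    ⟨(a, ⟨0, hR⟩, false), Finset.mem_univ _, ?_⟩
  have h2 := Real.exp_pos (-(d : ℝ) ^ 2)
  simpa [seedWeight, poissonWeight, ha] using h2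

/-- The factor with which the outcome for a seed contributes to the estimate at `x`. -/
def seedPhase {ι : Type} (F : ι → ℂ) (j : ι → ℤ) (R : ℕ) (x : ℝ) (s : ι × Fin R × Bool) : ℝ :=
  if s.2.2 then (F s.1 / ‖F s.1‖ * Complex.exp (((j s.1 * x : ℝ) : ℂ) * Complex.I)).im
  else (F s.1 / ‖F s.1‖ * Complex.exp (((j s.1 * x : ℝ) : ℂ) * Complex.I)).re

theorem abs_seedPhase_le {ι : Type} (F : ι → ℂ) (j : ι → ℤ) (R : ℕ) (x : ℝ) (s : ι × Fin R × Bool) :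
    |seedPhase F j R x s| ≤ 1 := by
  have h : ‖F s.1 / ‖F s.1‖ * Complex.exp (((j s.1 * x : ℝ) : ℂ) * Complex.I)‖ ≤ 1 := by
    rw [norm_mul, Complex.norm_exp_ofReal_mul_I, mul_one, norm_div, Complex.norm_real, norm_norm]
    exact div_self_le_one _
  unfold seedPhase
  split_ifs
  · exact (Complex.abs_im_le_norm _).trans h
  · exact (Complex.abs_re_le_norm _).trans h

/-- The mean of the estimator is close to the mean of the filter over the energy distribution. -/
theorem abs_sum_seedWeight_mul_sub_le {ι κ : Type} [Fintype ι] [Fintype κ] (F : ι → ℂ) (j : ι → ℤ) {d : ℕ}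
    (hd : 1 ≤ d) (hj : ∀ a, |j a| ≤ d) (w e : κ → ℝ) (hw : ∀ i, 0 ≤ w i) (hw1 : ∑ i, w i = 1)
    (he : ∀ i, |e i| ≤ 1) (x : ℝ) :
    |∑ s, seedWeight F j d s * (seedPhase F j (13 * d ^ 2) x s *
        ((if s.2.2 then Complex.I else 1) * ∑ i, (w i : ℂ) *
          (((Real.cos (stepAngle ((d : ℝ) ^ 2) (j s.1)) : ℝ) : ℂ) + Complex.I *
            ((Real.sin (stepAngle ((d : ℝ) ^ 2) (j s.1)) : ℝ) : ℂ) * (e i : ℂ)) ^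
              (s.2.1 : ℕ)).re) -
      ∑ i, w i * ∑ a, (F a * Complex.exp (((j a * (x - e i / 4) : ℝ) : ℂ) * Complex.I)).re| ≤
        (∑ a, ‖F a‖) * Real.exp (-(8 * (d : ℝ) ^ 2)) := by
  set v : ι → κ → ℂ := fun a i => ((Real.cos (stepAngle ((d : ℝ) ^ 2) (j a)) : ℝ) : ℂ) +
    Complex.I * ((Real.sin (stepAngle ((d : ℝ) ^ 2) (j a)) : ℝ) : ℂ) * (e i : ℂ) with hv
  set Q : ι → κ → ℂ := fun a i => ∑ N ∈ Finset.range (13 * d ^ 2),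
    ((poissonWeight ((d : ℝ) ^ 2) N * stepWeight ((d : ℝ) ^ 2) (j a) ^ N : ℝ) : ℂ) * v a i ^ N
    with hQ
  have h1 : ∑ s, seedWeight F j d s * (seedPhase F j (13 * d ^ 2) x s *
      ((if s.2.2 then Complex.I else 1) * ∑ i, (w i : ℂ) * v s.1 i ^ (s.2.1 : ℕ)).re) =
      ∑ a, ∑ i, w i * (F a * Complex.exp (((j a * x : ℝ) : ℂ) * Complex.I) * Q a i).re := by
    rw [Fintype.sum_prod_type]
    refine Finset.sum_congr rfl fun a _ => ?_
    rw [Fintype.sum_prod_type]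
    have hN : ∀ N : Fin (13 * d ^ 2), ∑ q : Bool, seedWeight F j d (a, N, q) *
        (seedPhase F j (13 * d ^ 2) x (a, N, q) *
          ((if q then Complex.I else 1) * ∑ i, (w i : ℂ) * v a i ^ (N : ℕ)).re) =
        ∑ i, w i * (F a * Complex.exp (((j a * x : ℝ) : ℂ) * Complex.I) *
          (((poissonWeight ((d : ℝ) ^ 2) N * stepWeight ((d : ℝ) ^ 2) (j a) ^ (N : ℕ) : ℝ) : ℂ) *
            v a i ^ (N : ℕ))).re := by
      intro N
      rw [Fintype.sum_bool]
      simp only [seedWeight, seedPhase, if_true, Bool.false_eq_true, if_false, one_mul]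
      set c := poissonWeight ((d : ℝ) ^ 2) N * stepWeight ((d : ℝ) ^ 2) (j a) ^ (N : ℕ)
      set E := Complex.exp (((j a * x : ℝ) : ℂ) * Complex.I)
      set t := ∑ i, (w i : ℂ) * v a i ^ (N : ℕ) with ht
      -- For `F a = 0` the quotient is `0` by convention, and the identity persists.
      have hF : F a = ((‖F a‖ : ℝ) : ℂ) * (F a / ‖F a‖) := by
        by_cases h0 : F a = 0
        · simp [h0]
        · field_simp
      -- The phase gate yields `Re(i t) = -Im t`, so the two tests recombine to the real part of the
      -- product.
      have hre : ∀ u : ℂ, u.im * (Complex.I * t).re + u.re * t.re = (u * t).re := by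
        intro u
        simp only [Complex.mul_re, Complex.I_re, Complex.I_im]
        ring
      calc _ = ‖F a‖ * c * ((F a / ‖F a‖ * E).im * (Complex.I * t).re +
            (F a / ‖F a‖ * E).re * t.re) := by ring
        _ = (((‖F a‖ * c : ℝ) : ℂ) * (F a / ‖F a‖ * E * t)).re := by
            rw [hre, Complex.re_ofReal_mul]
        _ = (F a * E * (c * t)).re := by
            congr 1
            conv_rhs => rw [hF]
            push_cast
            ring
        _ = _ := by
            rw [ht, Finset.mul_sum, Finset.mul_sum, Complex.re_sum]
            refine Finset.sum_congr rfl fun i _ => ?_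
            rw [← Complex.re_ofReal_mul]
            congr 1
            ring
    rw [Finset.sum_congr rfl fun N _ => hN N, Finset.sum_comm]
    refine Finset.sum_congr rfl fun i _ => ?_
    rw [hQ, ← Finset.mul_sum]
    simp only
    rw [← Complex.re_sum, ← Finset.mul_sum, Finset.sum_range]
  have h2 : ∑ i, w i * ∑ a, (F a * Complex.exp (((j a * (x - e i / 4) : ℝ) : ℂ) *
      Complex.I)).re = ∑ a, ∑ i, w i * (F a * Complex.exp (((j a * x : ℝ) : ℂ) * Complex.I) *
        Complex.exp (((-(j a * (e i / 4)) : ℝ) : ℂ) * Complex.I)).re := by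
    rw [Finset.sum_comm]
    refine Finset.sum_congr rfl fun i _ => ?_
    rw [Finset.mul_sum]
    refine Finset.sum_congr rfl fun a _ => ?_
    rw [mul_assoc (F a), ← Complex.exp_add, ← add_mul, ← Complex.ofReal_add]
    congr 6
    ring
  rw [h1, h2, ← Finset.sum_sub_distrib, Finset.sum_mul]
  refine (Finset.abs_sum_le_sum_abs _ _).trans (Finset.sum_le_sum fun a _ => ?_)
  rw [← Finset.sum_sub_distrib]
  refine (Finset.abs_sum_le_sum_abs _ _).trans ?_
  calc _ ≤ ∑ i, w i * (‖F a‖ * Real.exp (-(8 * (d : ℝ) ^ 2))) := by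
        refine Finset.sum_le_sum fun i _ => ?_
        rw [← mul_sub, abs_mul, abs_of_nonneg (hw i), ← Complex.sub_re, ← mul_sub]
        refine mul_le_mul_of_nonneg_left ((Complex.abs_re_le_norm _).trans ?_) (hw i)
        rw [norm_mul, norm_mul, Complex.norm_exp_ofReal_mul_I, mul_one]
        exact mul_le_mul_of_nonneg_left (norm_sum_step_sub_exp_le hd (hj a) (he i)) (norm_nonneg _)
    _ = _ := by rw [← Finset.sum_mul, hw1, one_mul]

/-- The probability mass function proportional to given weights. -/
def weightPMF {S : Type} [Fintype S] (a : S → ℝ) (h0 : ∀ s, 0 ≤ a s) (h : 0 < ∑ s, a s) : PMF S :=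
  PMF.ofFintype (fun s => ENNReal.ofReal (a s / ∑ t, a t)) (by
    rw [← ENNReal.ofReal_sum_of_nonneg fun s _ => div_nonneg (h0 s) h.le, ← Finset.sum_div,
      div_self h.ne', ENNReal.ofReal_one])

theorem weightPMF_toReal {S : Type} [Fintype S] (a : S → ℝ) (h0 : ∀ s, 0 ≤ a s)
    (h : 0 < ∑ s, a s) (s : S) : (weightPMF a h0 h s).toReal = a s / ∑ t, a t := by
  rw [weightPMF, PMF.ofFintype_apply, ENNReal.toReal_ofReal (div_nonneg (h0 s) h.le)]

/-- The ground state energy estimation algorithm for a given step filter `F`, in terms of the number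
`N` of samples. -/
theorem exists_algorithm_of_filter {n : ℕ} {lam Δ η ξ M : ℝ} (hlam : 0 < lam) (hΔ : 0 < Δ)
    (hΔlam : Δ ≤ lam) (hη : 0 < η) (hξ : 0 < ξ) {d : ℕ} {ι : Type} [Fintype ι] {F : ι → ℂ}
    {j : ι → ℤ} (hd : 1 ≤ d) (hj : ∀ a, |j a| ≤ d) (hM : ∑ a, ‖F a‖ ≤ M)
    (hG0 : ∀ y : ℝ, 0 ≤ ∑ a, (F a * Complex.exp (((j a * y : ℝ) : ℂ) * Complex.I)).re)
    (hG1 : ∀ y : ℝ, Δ / (16 * lam) ≤ y → y ≤ 1 →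
      1 ≤ ∑ a, (F a * Complex.exp (((j a * y : ℝ) : ℂ) * Complex.I)).re)
    (hG2 : ∀ y : ℝ, -1 ≤ y → y ≤ -(Δ / (16 * lam)) →
      ∑ a, (F a * Complex.exp (((j a * y : ℝ) : ℂ) * Complex.I)).re ≤ η / 4)
    (herr : M * Real.exp (-(8 * (d : ℝ) ^ 2)) ≤ η / 8) {k N : ℕ}
    (hk1 : 2 * lam ≤ 2 ^ k * Δ) (hk2 : 2 ^ k * Δ ≤ 4 * lam) (hN : 0 < N)
    (hNξ : 4 * k * Real.exp (-(N * (η / 8) ^ 2 / (2 * (4 * M) ^ 2))) ≤ ξ) :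
    ∃ A : Algorithm n, A.numCircuits = N ∧ ∀ H : Hamiltonian n, H.weight = lam →
      (∀ i, ∀ c ∈ (A.circuitLaw H i).support,
        (Circuit.rotationCount c : ℝ) ≤ 26 * (d : ℝ) ^ 2) ∧
      ∀ ρ : QState n, η ≤ H.overlap ρ → ENNReal.ofReal (1 - ξ) ≤
        A.law H ρ {ω | |A.estimate ω - H.groundEnergy| ≤ Δ} := by
  have hF : ∃ a, F a ≠ 0 := by
    by_contra hcon
    push Not at hcon
    have h := hG1 1 (by rw [div_le_one (by positivity)]; linarith) le_rfl
    simp only [hcon, zero_mul, Complex.zero_re, Finset.sum_const_zero] at h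
    linarith
  have hM0 : 0 < M := by
    obtain ⟨a, ha⟩ := hF
    exact (Finset.sum_pos' (fun a _ => norm_nonneg (F a))
      ⟨a, Finset.mem_univ _, norm_pos_iff.2 ha⟩).trans_le hM
  set S := ι × Fin (13 * d ^ 2) × Bool
  have hne : Nonempty S := by
    obtain ⟨a, _⟩ := hF
    have hR : 0 < 13 * d ^ 2 := by positivity
    exact ⟨(a, ⟨0, hR⟩, false)⟩
  set a : S → ℝ := seedWeight F j d with ha
  set W := ∑ s, a s with hW
  have hW0 : 0 < W := sum_seedWeight_pos F j hd hF
  have hWM : W ≤ 4 * M := (sum_seedWeight_le F j hd hj).trans (by linarith)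
  set p : PMF S := weightPMF a (seedWeight_nonneg F j d) hW0 with hp
  set T : S → List (Instruction n) := fun s =>
    testTemplate n (stepAngle ((d : ℝ) ^ 2) (j s.1)) s.2.1 s.2.2 with hT
  set z : ℝ → S → ℝ := fun x s => W * seedPhase F j (13 * d ^ 2) (x / (4 * lam)) s with hz
  -- The samples do not depend on `x`; only the phases `z x` attached to them do.
  set emp : (Fin N → S × Bool) → ℝ → ℝ := fun ω x =>
    (∑ i, (if (ω i).2 then -1 else 1) * z x (ω i).1) / N
  -- Bias and sampling error of at most `η/8` each leave values at most `η/2` below `E` and at least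
  -- `3η/4` above it; the threshold is the midpoint.
  set dec : (Fin N → S × Bool) → ℕ → Bool := fun ω m =>
    decide (emp ω (-lam + m * Δ) ≤ 5 * η / 8)
  set est : (Fin N → S × Bool) → ℝ := fun ω => -lam + bisect (dec ω) k 0 * Δ + Δ / 2
  refine ⟨repeatedAlgorithm N p T est, rfl, fun H hH => ⟨fun i c hc => ?_, fun ρ hρ => ?_⟩⟩
  · obtain ⟨s, hs⟩ := mem_support_circuitLaw_repeatedAlgorithm hc
    have h1 := rotationCount_le_of_mem_support_testTemplate H _ _ _ c hs
    have h2 : Circuit.rotationCount c ≤ 26 * d ^ 2 := by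
      have := s.2.1.2
      omega
    exact_mod_cast h2
  obtain ⟨w, hw0, hw1, hwo, hwt⟩ := H.exists_energy_distribution ρ
  set E := H.groundEnergy with hE
  have hElam : |E| ≤ lam := hH ▸ H.abs_groundEnergy_le
  have hEi : ∀ i, E ≤ H.energy i := H.groundEnergy_le
  have hEilam : ∀ i, |H.energy i| ≤ lam := fun i => hH ▸ H.abs_energy_le i
  set Z : ℝ → ℕ × Bool → ℝ := fun x b => (if b.2 then -1 else 1) * z x (seedOf b.1) with hZ
  set g : ℝ → ℝ := fun x => ∑ i, w i * ∑ b, (F b * Complex.exp (((j b *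
    (x / (4 * lam) - H.energy i / lam / 4) : ℝ) : ℂ) * Complex.I)).re with hg
  set mean : ℝ → ℝ := fun x => ∑ s, a s * (seedPhase F j (13 * d ^ 2) (x / (4 * lam)) s *
    ((if s.2.2 then Complex.I else 1) * ∑ i, (w i : ℂ) *
      (((Real.cos (stepAngle ((d : ℝ) ^ 2) (j s.1)) : ℝ) : ℂ) + Complex.I *
        ((Real.sin (stepAngle ((d : ℝ) ^ 2) (j s.1)) : ℝ) : ℂ) *
          ((H.energy i / lam : ℝ) : ℂ)) ^ (s.2.1 : ℕ)).re) with hmean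
  have hmg : ∀ x, |mean x - g x| ≤ η / 8 := fun x =>
    (abs_sum_seedWeight_mul_sub_le F j hd hj w (fun i => H.energy i / lam) hw0 hw1
      (fun i => by rw [abs_div, abs_of_pos hlam, div_le_one hlam]; exact hEilam i)
      (x / (4 * lam))).trans
      ((mul_le_mul_of_nonneg_right hM (Real.exp_pos _).le).trans herr)
  have hint : ∀ x i, ∫ b, Z x b ∂((repeatedAlgorithm N p T est).roundLaw H ρ i).toMeasure =
      mean x := by
    intro x i
    refine (integral_roundLaw_repeatedAlgorithm N p T est H ρ i (z x)).trans ?_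
    refine Finset.sum_congr rfl fun s _ => ?_
    rw [hp, weightPMF_toReal, hT]
    simp only
    rw [compileExp_testTemplate, hwt, hz, hH, ← hW]
    have hW' := hW0.ne'
    field_simp
  have hZbd : ∀ x b, |Z x b| ≤ 4 * M := by
    intro x b
    have h1 : |z x (seedOf b.1)| ≤ W := by
      rw [hz, abs_mul, abs_of_pos hW0]
      exact mul_le_of_le_one_right hW0.le (abs_seedPhase_le F j _ _ _)
    rw [hZ]
    simp only
    rw [abs_mul]
    have h2 : |(if b.2 = true then -1 else 1 : ℝ)| = 1 := by split_ifs <;> simp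
    rw [h2, one_mul]
    exact h1.trans hWM
  have hroundprob : ∀ i : Fin N,
      IsProbabilityMeasure ((repeatedAlgorithm N p T est).roundLaw H ρ i).toMeasure :=
    fun i => PMF.toMeasure.isProbabilityMeasure _
  have hconc : ∀ x, ((repeatedAlgorithm N p T est).law H ρ).real
      {ω | η / 8 ≤ |(∑ i : Fin N, Z x (ω i)) / N - mean x|} ≤
        2 * Real.exp (-(N * (η / 8) ^ 2 / (2 * (4 * M) ^ 2))) := fun x =>
    measureReal_abs_mean_sub_ge_le hN
      (fun i : Fin N => ((repeatedAlgorithm N p T est).roundLaw H ρ i).toMeasure)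
      (measurable_of_countable _) (by positivity) (by positivity) (hZbd x) (hint x)
  -- The distance `Δ/4` to every energy becomes `Δ/(16λ)` after division by `4λ`, the resolution of
  -- the filter.
  have hglow : ∀ x, -lam ≤ x → x ≤ E - Δ / 4 → g x ≤ η / 4 := by
    intro x hx1 hx2
    calc g x ≤ ∑ i, w i * (η / 4) := by
          refine Finset.sum_le_sum fun i _ => mul_le_mul_of_nonneg_left (hG2 _ ?_ ?_) (hw0 i)
          · rw [div_div, mul_comm lam 4, ← sub_div, le_div_iff₀ (by positivity)]
            have := (abs_le.1 (hEilam i)).2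
            linarith
          · rw [div_div, mul_comm lam 4, ← sub_div, ← neg_div,
              div_le_div_iff₀ (by positivity) (by positivity)]
            have := hEi i
            nlinarith
      _ = η / 4 := by rw [← Finset.sum_mul, hw1, one_mul]
  -- Only the ground space is counted. The bound `x ≤ 3λ` keeps its arguments below `1`.
  have hghigh : ∀ x, x ≤ 3 * lam → E + Δ / 4 ≤ x → η ≤ g x := by
    intro x hx1 hx2
    rw [hwo] at hρ
    refine hρ.trans ?_
    rw [Finset.sum_filter]
    refine Finset.sum_le_sum fun i _ => ?_
    split_ifs with hi
    · refine le_mul_of_one_le_right (hw0 i) (hG1 _ ?_ ?_)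
      · rw [hi, div_div, mul_comm lam 4, ← sub_div,
          div_le_div_iff₀ (by positivity) (by positivity)]
        nlinarith
      · rw [div_div, mul_comm lam 4, ← sub_div, div_le_one (by positivity)]
        have := (abs_le.1 (hEilam i)).1
        linarith
    · exact mul_nonneg (hw0 i) (hG0 _)
  -- This set is fixed before the outcomes are drawn, so a union bound over its at most `2k` points
  -- is legitimate despite the adaptive search.
  obtain ⟨s, hcard, hlt, hbis⟩ := exists_bisect_points k (-lam) Δ E hΔ
    (by linarith [(abs_le.1 hElam).1]) (by linarith [(abs_le.1 hElam).2])
  set bad : Set (Fin N → ℕ × Bool) := ⋃ m ∈ s,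
    {ω | η / 8 ≤ |(∑ i : Fin N, Z (-lam + m * Δ) (ω i)) / N - mean (-lam + m * Δ)|} with hbad
  have hgood : ∀ ω, ω ∉ bad → |(repeatedAlgorithm N p T est).estimate ω - E| ≤ Δ := by
    intro ω hω
    refine hbis _ fun m hm => ?_
    have hω' : |(∑ i : Fin N, Z (-lam + m * Δ) (ω i)) / N - mean (-lam + m * Δ)| < η / 8 := by
      by_contra hcon
      refine hω (Set.mem_biUnion hm ?_)
      exact not_lt.1 hcon
    have hm0 : (0 : ℝ) ≤ m * Δ := by positivity
    have hm1 : (m : ℝ) * Δ ≤ 4 * lam := by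
      have h1 : (m : ℝ) ≤ 2 ^ k := by exact_mod_cast (hlt m hm).le
      exact (mul_le_mul_of_nonneg_right h1 hΔ.le).trans hk2
    have h1 := abs_lt.1 hω'
    have h2 := abs_le.1 (hmg (-lam + m * Δ))
    constructor
    · intro h3
      have h4 := hglow _ (by linarith) h3
      refine decide_eq_true ?_
      change (∑ i : Fin N, Z (-lam + m * Δ) (ω i)) / N ≤ 5 * η / 8
      linarith
    · intro h3
      have h4 := hghigh _ (by linarith) h3
      refine decide_eq_false ?_
      change ¬ (∑ i : Fin N, Z (-lam + m * Δ) (ω i)) / N ≤ 5 * η / 8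
      linarith
  have hprob : IsProbabilityMeasure ((repeatedAlgorithm N p T est).law H ρ) := by
    unfold Algorithm.law
    infer_instance
  have hbadm : (repeatedAlgorithm N p T est).law H ρ bad ≤ ENNReal.ofReal ξ := by
    refine (ENNReal.le_ofReal_iff_toReal_le (measure_ne_top _ _) hξ.le).2 ?_
    change ((repeatedAlgorithm N p T est).law H ρ).real bad ≤ ξ
    refine le_trans ?_ hNξ
    refine (measureReal_biUnion_finset_le _ _).trans ((Finset.sum_le_sum fun (m : ℕ) _ =>
      hconc (-lam + (m : ℝ) * Δ)).trans ?_)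
    rw [Finset.sum_const, nsmul_eq_mul]
    have hcard' : (s.card : ℝ) ≤ 2 * k := by exact_mod_cast hcard
    have hexp := Real.exp_pos (-(N * (η / 8) ^ 2 / (2 * (4 * M) ^ 2)))
    nlinarith
  have huniv : (1 : ℝ≥0∞) ≤ (repeatedAlgorithm N p T est).law H ρ
      {ω | |(repeatedAlgorithm N p T est).estimate ω - E| ≤ Δ} +
        (repeatedAlgorithm N p T est).law H ρ bad := by
    rw [← measure_univ (μ := (repeatedAlgorithm N p T est).law H ρ)]
    refine le_trans (measure_mono fun ω _ => ?_) (measure_union_le _ _)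
    by_cases hω : ω ∈ bad
    · exact Or.inr hω
    · exact Or.inl (hgood ω hω)
  rw [ENNReal.ofReal_sub 1 hξ.le, ENNReal.ofReal_one, tsub_le_iff_right]
  exact huniv.trans (add_le_add le_rfl hbadm)

/-- For a precision above the total weight no circuit has to be run. -/
theorem exists_algorithm_of_weight_le {n : ℕ} {lam Δ ξ : ℝ} (h : lam ≤ Δ) (hξ : 0 < ξ) :
    ∃ A : Algorithm n, A.numCircuits = 0 ∧ ∀ H : Hamiltonian n, H.weight = lam →
      ∀ ρ : QState n, ENNReal.ofReal (1 - ξ) ≤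
        A.law H ρ {ω | |A.estimate ω - H.groundEnergy| ≤ Δ} := by
  refine ⟨⟨0, fun _ => PMF.pure 0, fun _ _ => [], fun _ => 0⟩, rfl, fun H hH ρ => ?_⟩
  have hE : |0 - H.groundEnergy| ≤ Δ := by
    rw [zero_sub, abs_neg]
    exact H.abs_groundEnergy_le.trans (hH.le.trans h)
  have hset : {ω : Fin 0 → ℕ × Bool | |(0 : ℝ) - H.groundEnergy| ≤ Δ} = Set.univ :=
    Set.eq_univ_of_forall fun _ => hE
  have hprob : IsProbabilityMeasure (Algorithm.law
      (⟨0, fun _ => PMF.pure 0, fun _ _ => [], fun _ => 0⟩ : Algorithm n) H ρ) := by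
    unfold Algorithm.law
    infer_instance
  refine le_trans ?_ (le_of_eq ((congrArg _ hset).trans measure_univ).symm)
  rw [← ENNReal.ofReal_one]
  exact ENNReal.ofReal_le_ofReal (by linarith)

/-- The lower bound makes the grid starting at `-λ` cover `[-λ, λ]`; the upper bound keeps it below
`3λ`, inside the range where the filter is controlled. -/
theorem exists_bisection_depth {lam Δ : ℝ} (hΔ : 0 < Δ) (h : Δ ≤ lam) :
    ∃ k : ℕ, 2 * lam ≤ 2 ^ k * Δ ∧ 2 ^ k * Δ ≤ 4 * lam ∧ (k : ℝ) ≤ 4 * plog (lam / Δ) := by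
  have hx : 1 ≤ lam / Δ := by rwa [le_div_iff₀ hΔ, one_mul]
  obtain ⟨m, hm1, hm2⟩ := exists_nat_pow_near (x := 2 * (lam / Δ)) (y := 2) (by linarith)
    one_lt_two
  have hlam : lam / Δ * Δ = lam := div_mul_cancel₀ lam hΔ.ne'
  refine ⟨m + 1, ?_, ?_, ?_⟩
  · have := mul_le_mul_of_nonneg_right hm2.le hΔ.le
    linarith
  · have := mul_le_mul_of_nonneg_right hm1 hΔ.le
    rw [pow_succ]
    linarith
  · have hp : 1 ≤ plog (lam / Δ) := one_le_plog (by linarith)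
    have hlog := Real.log_le_log (by positivity) hm1
    rw [Real.log_pow, Real.log_mul two_ne_zero (by linarith)] at hlog
    have hle : Real.log (lam / Δ) ≤ plog (lam / Δ) :=
      Real.log_le_log (by linarith) (by linarith [Real.exp_pos 1])
    have h2 := Real.log_two_gt_d9
    push_cast
    nlinarith [(Nat.cast_nonneg m : (0 : ℝ) ≤ m)]

/-- `8d²` dominates `plog (1 / η) + 6 + d`; the three exponentials supply `η`, `1/128` and a factor
absorbing `1 + log d ≤ d`. -/
theorem mul_exp_neg_le {d : ℕ} {η : ℝ} (hη : 0 < η) (hd : plog (1 / η) ≤ d) :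
    16 * (1 + Real.log d) * Real.exp (-(8 * (d : ℝ) ^ 2)) ≤ η / 8 := by
  have hp : 1 ≤ plog (1 / η) := one_le_plog (by positivity)
  have hd1 : (1 : ℝ) ≤ d := hp.trans hd
  have h1 : 1 + Real.log d ≤ d := by
    linarith [Real.log_le_sub_one_of_pos (show (0 : ℝ) < d by linarith)]
  have h2 : (d : ℝ) ≤ Real.exp d := by linarith [Real.add_one_le_exp (d : ℝ)]
  have h3 : Real.exp (-(8 * (d : ℝ) ^ 2)) ≤
      Real.exp (-plog (1 / η)) * Real.exp (-6) * Real.exp (-d) := by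
    rw [← Real.exp_add, ← Real.exp_add, Real.exp_le_exp]
    nlinarith
  have h4 : 128 * Real.exp (-6) ≤ 1 := by
    have h : (128 : ℝ) ≤ Real.exp 6 := by
      have h1 := Real.exp_one_gt_d9
      have : Real.exp 6 = Real.exp 1 ^ 6 := by rw [← Real.exp_nat_mul]; norm_num
      rw [this]
      calc (128 : ℝ) ≤ (2.7 : ℝ) ^ 6 := by norm_num
        _ ≤ _ := pow_le_pow_left₀ (by norm_num) (by linarith) 6
    rw [Real.exp_neg, ← div_eq_mul_inv, div_le_one (Real.exp_pos _)]
    exact h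
  have h5 : (d : ℝ) * Real.exp (-d) ≤ 1 := by
    rw [Real.exp_neg, ← div_eq_mul_inv, div_le_one (Real.exp_pos _)]
    exact h2
  calc 16 * (1 + Real.log d) * Real.exp (-(8 * (d : ℝ) ^ 2))
      ≤ 16 * d * (Real.exp (-plog (1 / η)) * Real.exp (-6) * Real.exp (-d)) := by
        gcongr
    _ = Real.exp (-plog (1 / η)) * (128 * Real.exp (-6)) * (d * Real.exp (-d)) / 8 := by ring
    _ ≤ η * 1 * 1 / 8 := by
        have := exp_neg_plog_le hη
        gcongr
    _ = η / 8 := by ring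

theorem log_mul_le_plog {c r x : ℝ} (hc : 0 < c) (hx : 1 ≤ x) (h : Real.log c ≤ r) (hr : 0 ≤ r) :
    Real.log (c * x) ≤ (r + 1) * plog x := by
  have hp : 1 ≤ plog x := one_le_plog (by linarith)
  have hle : Real.log x ≤ plog x :=
    Real.log_le_log (by linarith) (by linarith [Real.exp_pos 1])
  rw [Real.log_mul hc.ne' (by linarith)]
  nlinarith

end GroundEnergy

end

/-! ### Choice of the parameters and of the universal constant. -/

theorem theorem1 :
    ∃ C : ℝ, 0 < C ∧
      ∀ (n : ℕ) (lam Δ η ξ : ℝ), 0 < lam → 0 < Δ → 0 < η → η ≤ 1 → 0 < ξ → ξ < 1 →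
        ∃ A : GroundEnergy.Algorithm n,
          (A.numCircuits : ℝ) ≤
              C * (1 / η ^ 2 *
                GroundEnergy.plog (lam / Δ * GroundEnergy.plog (1 / η)) ^ 2 *
                GroundEnergy.plog (1 / ξ * GroundEnergy.plog (lam / Δ))) ∧
          ∀ H : GroundEnergy.Hamiltonian n, H.weight = lam →
            (∀ i, ∀ c ∈ (A.circuitLaw H i).support,
              (GroundEnergy.Circuit.rotationCount c : ℝ) ≤
                C * (lam ^ 2 / Δ ^ 2 * GroundEnergy.plog (1 / η) ^ 2)) ∧
            ∀ ρ : GroundEnergy.QState n, η ≤ H.overlap ρ →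
              ENNReal.ofReal (1 - ξ) ≤
                A.law H ρ {ω | |A.estimate ω - H.groundEnergy| ≤ Δ} := by
  open GroundEnergy in
  refine ⟨10 ^ 10, by norm_num, fun n lam Δ η ξ hlam hΔ hη hη1 hξ hξ1 => ?_⟩
  have hL1 : 1 ≤ plog (1 / η) := one_le_plog (by positivity)
  have hLx : 1 ≤ plog (lam / Δ) := one_le_plog (by positivity)
  rcases le_or_gt lam Δ with hle | hlt
  · obtain ⟨A, hA0, hA⟩ := exists_algorithm_of_weight_le (n := n) hle hξ
    refine ⟨A, ?_, fun H hH => ⟨fun i => absurd i.2 (by omega), fun ρ _ => hA H hH ρ⟩⟩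
    have hY : 1 ≤ plog (lam / Δ * plog (1 / η)) := one_le_plog (by positivity)
    have hX : 1 ≤ plog (1 / ξ * plog (lam / Δ)) := one_le_plog (by positivity)
    rw [hA0, Nat.cast_zero]
    positivity
  have hratio : 1 ≤ lam / Δ := by rw [le_div_iff₀ hΔ]; linarith
  obtain ⟨k, hk1, hk2, hk3⟩ := exists_bisection_depth hΔ hlt.le
  obtain ⟨d, ι, _, F, j, hd1, hd2, hj, hF, hG0, hG1, hG2⟩ :=
    exists_step_filter (δ := Δ / (16 * lam)) (η := η) (by positivity)
      (by rw [div_le_iff₀ (by positivity)]; linarith) hη hη1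
  have hdR : (1 : ℝ) ≤ d := hL1.trans hd1
  have hd : 1 ≤ d := by exact_mod_cast hdR
  set M := 16 * (1 + Real.log d) with hM
  set Y := plog (lam / Δ * plog (1 / η)) with hY
  set X := plog (1 / ξ * plog (lam / Δ)) with hX
  have hlogd : 0 ≤ Real.log d := Real.log_nonneg hdR
  have hM0 : 0 < M := by positivity
  -- `2016 = 126 · 16`, the degree constant of the filter times the factor in `δ = Δ/(16λ)`.
  have hd3 : (d : ℝ) ≤ 2016 * (lam / Δ * plog (1 / η)) := by
    refine hd2.trans_eq ?_
    field_simp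
    norm_num
  have hY1 : 1 ≤ Y := one_le_plog (by positivity)
  have hX1 : 1 ≤ X := one_le_plog (by positivity)
  have harg : 1 ≤ lam / Δ * plog (1 / η) := one_le_mul_of_one_le_of_one_le hratio hL1
  have hMY : M ≤ 160 * Y := by
    have hlog : Real.log 2016 ≤ 8 := by
      rw [Real.log_le_iff_le_exp (by norm_num)]
      have h1 := Real.exp_one_gt_d9
      have : Real.exp 8 = Real.exp 1 ^ 8 := by rw [← Real.exp_nat_mul]; norm_num
      rw [this]
      calc (2016 : ℝ) ≤ (2.7 : ℝ) ^ 8 := by norm_num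
        _ ≤ _ := pow_le_pow_left₀ (by norm_num) (by linarith) 8
    have h1 := Real.log_le_log (by linarith) hd3
    have h2 := log_mul_le_plog (c := 2016) (by norm_num) harg hlog (by norm_num)
    rw [hM]
    linarith
  -- For deviation `η/8` and range `4M` Hoeffding's exponent is `N η²/(2048 M²)`, here at least
  -- `4X`. As `log 16 ≤ 3`, `exp(-4X)` is at most `ξ/(16 Log(λ/Δ))`, which cancels `4k ≤ 16
  -- Log(λ/Δ)` in the union bound.
  set B := 2048 * M ^ 2 / η ^ 2 * (4 * X) with hB
  have hB0 : 0 < B := by positivity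
  obtain ⟨A, hAN, hA⟩ := exists_algorithm_of_filter (n := n) hlam hΔ hlt.le hη hξ hd hj hF hG0 hG1
    hG2 (mul_exp_neg_le hη hd1) (k := k) (N := ⌈B⌉₊) hk1 hk2 (Nat.ceil_pos.2 hB0) (by
      have hexp : 4 * X ≤ (⌈B⌉₊ : ℝ) * (η / 8) ^ 2 / (2 * (4 * M) ^ 2) := by
        calc 4 * X = B * (η / 8) ^ 2 / (2 * (4 * M) ^ 2) := by
              rw [hB]
              field_simp
              norm_num
          _ ≤ _ := by
              have := Nat.le_ceil B
              gcongr
      have hlog16 : Real.log 16 ≤ 3 := by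
        rw [Real.log_le_iff_le_exp (by norm_num)]
        have h1 := Real.exp_one_gt_d9
        have : Real.exp 3 = Real.exp 1 ^ 3 := by rw [← Real.exp_nat_mul]; norm_num
        rw [this]
        calc (16 : ℝ) ≤ (2.7 : ℝ) ^ 3 := by norm_num
          _ ≤ _ := pow_le_pow_left₀ (by norm_num) (by linarith) 3
      have hinv : 1 ≤ 1 / ξ := by rw [le_div_iff₀ hξ]; linarith
      have harg' : 1 ≤ 1 / ξ * plog (lam / Δ) := one_le_mul_of_one_le_of_one_le hinv hLx
      have h16 := log_mul_le_plog (c := 16) (by norm_num) harg' hlog16 (by norm_num)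
      have h5 : Real.exp (-(4 * X)) ≤ (16 * (1 / ξ * plog (lam / Δ)))⁻¹ := by
        rw [Real.exp_neg]
        refine inv_anti₀ (by positivity) ?_
        rw [← Real.log_le_iff_le_exp (by positivity)]
        linarith
      calc 4 * k * Real.exp (-((⌈B⌉₊ : ℝ) * (η / 8) ^ 2 / (2 * (4 * M) ^ 2)))
          ≤ 4 * (4 * plog (lam / Δ)) * (16 * (1 / ξ * plog (lam / Δ)))⁻¹ := by
            refine mul_le_mul (by linarith) ((Real.exp_le_exp.2 (neg_le_neg hexp)).trans h5)
              (Real.exp_pos _).le (by positivity)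
        _ = ξ := by
            have : plog (lam / Δ) ≠ 0 := by linarith
            field_simp
            norm_num)
  refine ⟨A, ?_, fun H hH => ⟨fun i c hc => ((hA H hH).1 i c hc).trans ?_, (hA H hH).2⟩⟩
  · rw [hAN]
    have h1 : 1 ≤ 1 / η ^ 2 * Y ^ 2 * X := by
      have h2 : 1 ≤ 1 / η ^ 2 := by
        rw [le_div_iff₀ (by positivity)]
        nlinarith
      exact one_le_mul_of_one_le_of_one_le
        (one_le_mul_of_one_le_of_one_le h2 (one_le_pow₀ hY1)) hX1
    have h3 : B ≤ 2048 * (160 * Y) ^ 2 / η ^ 2 * (4 * X) := by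
      rw [hB]
      gcongr
    calc (⌈B⌉₊ : ℝ) ≤ B + 1 := (Nat.ceil_lt_add_one hB0.le).le
      _ ≤ 2048 * (160 * Y) ^ 2 / η ^ 2 * (4 * X) + 1 / η ^ 2 * Y ^ 2 * X := add_le_add h3 h1
      _ = 209715201 * (1 / η ^ 2 * Y ^ 2 * X) := by ring
      _ ≤ _ := mul_le_mul_of_nonneg_right (by norm_num) (by linarith)
  · calc 26 * (d : ℝ) ^ 2 ≤ 26 * (2016 * (lam / Δ * plog (1 / η))) ^ 2 := by gcongr
      _ = 26 * 2016 ^ 2 * (lam ^ 2 / Δ ^ 2 * plog (1 / η) ^ 2) := by ring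
      _ ≤ _ := mul_le_mul_of_nonneg_right (by norm_num) (by positivity)
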